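/- Let $n\ge 2$ and $1\le k\le n-1$. Let $[x,y]=-x_1y_1-\dots-x_ny_n+x_{n+1}y_{n+1}$ on $\mathbb R^{n+1}$, let $\mathbb H^n=\{x\in\mathbb R^{n+1}:[x,x]=1,\ x_{n+1}>0\}$ be the hyperbolic space with its Riemannian measure $dx=\sinh^{n-1}\omega\,d\omega\,d\sigma(\zeta)$ in polar coordinates $x=\zeta\sinh\omega+e_{n+1}\cosh\omega$ ($\zeta\in S^{n-1}$, $\omega>0$), and let $G=SO_0(n,1)$. Let $\xi_0=\{x\in\mathbb H^n:x_1=\dots=x_{n-k}=0\}\cong\mathbb H^k$, and let $\Xi=\{g\xi_0:g\in G\}$ be the space of $k$-dimensional totally geodesic submanifolds of $\mathbb H^n$ ("$k$-geodesics"); "almost all $\xi\in\Xi$" refers to the $G$-invariant measure class on $\Xi$ (a subset of $\Xi$ is null iff its preimage under $g\mapsto g\xi_0$ is null for Haar measure on $G$). For $f:\mathbb H^n\to\mathbb R$ or $\mathbb C$ and $\xi\in\Xi$ let $$(Rf)(\xi)=\int_\xi f(x)\,d_\xi x=\int_{\mathbb H^k} f(r_\xi y)\,dy,\qquad r_\xi\in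 G,\ r_\xi\xi_0=\xi,$$ where $d_\xi x$ is the Riemannian measure of $\xi$; we say that $(Rf)(\xi)$ is finite if this integral converges absolutely. For $\mu\in\mathbb R$ let $C_\mu(\mathbb H^n)$ be the space of continuous functions $f$ on $\mathbb H^n$ with $f(x)=O(x_{n+1}^{-\mu})$ at infinity. For $k=1$ put $(n-1)/(k-1)=\infty$. (i) If $f\in L^p(\mathbb H^n)$ with $1\le p<(n-1)/(k-1)$, then $(Rf)(\xi)$ is finite for almost all $\xi\in\Xi$. (ii) If $f\in C_\mu(\mathbb H^n)$ with $\mu>k-1$, then $(Rf)(\xi)$ is finite for all $\xi\in\Xi$. These ranges are sharp: for every $p$ with $(n-1)/(k-1)\le p\le\infty$ there is a nonnegative continuous $f\in L^p(\mathbb H^n)$ with $(Rf)(\xi)=\infty$ for every $\xi\in\Xi$, and for every $\mu\le k-1$ there is a nonnegative $f\in C_\mu(\mathbb H^n)$ with $(Rf)(\xi)=\infty$ for every $\xi\in\Xi$. -/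

import Mathlib

open MeasureTheory Set
open scoped ENNReal

noncomputable section

namespace HypRadon

/-- The pseudo-Euclidean inner product
`[x, y] = - x₁ y₁ - ⋯ - xₙ yₙ + xₙ₊₁ yₙ₊₁` on `ℝⁿ⁺¹`. -/
def mink {n : ℕ} (x y : Fin (n + 1) → ℝ) : ℝ :=
  -(∑ i : Fin n, x i.castSucc * y i.castSucc) + x (Fin.last n) * y (Fin.last n)

/-- The upper sheet `{x : [x, x] = 1, xₙ₊₁ > 0}` of the two-sheeted hyperboloid. -/
def hyperboloid (n : ℕ) : Set (Fin (n + 1) → ℝ) :=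
  {x | mink x x = 1 ∧ 0 < x (Fin.last n)}

/-- Real hyperbolic space `ℍⁿ` in the hyperboloid model (with the subspace topology and the
Borel `σ`-algebra). -/
abbrev Hyp (n : ℕ) : Type := hyperboloid n

/-- The coordinate `xₙ₊₁ = cosh d(x₀, x)` of a point of `ℍⁿ`, where `x₀ = (0, …, 0, 1)`. -/
def height {n : ℕ} (x : Hyp n) : ℝ := x.1 (Fin.last n)

/-- Hyperbolic polar coordinates `(ω, ζ) ↦ ζ sinh ω + eₙ₊₁ cosh ω`, with `ζ` in the unit sphere
`Sⁿ⁻¹` of the hyperplane `xₙ₊₁ = 0`. -/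
def polar (n : ℕ) (q : ℝ × Metric.sphere (0 : EuclideanSpace ℝ (Fin n)) 1) : Hyp n :=
  ⟨Fin.snoc (α := fun _ => ℝ) (fun i => Real.sinh q.1 * q.2.1 i) (Real.cosh q.1), by
    have h := q.2.2
    rw [mem_sphere_zero_iff_norm, EuclideanSpace.norm_eq, Real.sqrt_eq_one] at h
    have h' : ∑ i, q.2.1 i * q.2.1 i = 1 := by
      refine Eq.trans (Finset.sum_congr rfl fun i _ => ?_) h
      rw [Real.norm_eq_abs, sq_abs, sq]
    refine ⟨?_, ?_⟩
    · have e : ∀ i : Fin n, Real.sinh q.1 * q.2.1 i * (Real.sinh q.1 * q.2.1 i)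
          = Real.sinh q.1 ^ 2 * (q.2.1 i * q.2.1 i) := fun i => by ring
      simp only [mink, Fin.snoc_castSucc, Fin.snoc_last, e, ← Finset.mul_sum, h']
      nlinarith [Real.cosh_sq q.1]
    · simpa using Real.cosh_pos q.1⟩

/-- The Riemannian measure of `ℍⁿ`, in polar coordinates `dx = sinhⁿ⁻¹ ω dω dσ(ζ)`, where `dσ` is
the surface measure of `Sⁿ⁻¹`. -/
def hypVolume (n : ℕ) : Measure (Hyp n) :=
  (((volume.restrict (Ioi (0 : ℝ))).withDensity
      fun ω => ENNReal.ofReal (Real.sinh ω ^ (n - 1))).prod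
    (volume : Measure (EuclideanSpace ℝ (Fin n))).toSphere).map (polar n)

/-- Membership of a continuous function in the class `C_μ(ℍⁿ)`: it is continuous and
`f(x) = O(xₙ₊₁ ^ (-μ))` at infinity. -/
def MemC {𝕜 : Type*} [NormedAddCommGroup 𝕜] {n : ℕ} (μ : ℝ) (f : Hyp n → 𝕜) : Prop :=
  Continuous f ∧ f =O[Filter.cocompact (Hyp n)] fun x => height x ^ (-μ)

theorem last_ne_zero {n : ℕ} {x : Fin (n + 1) → ℝ} (h : mink x x = 1) :
    x (Fin.last n) ≠ 0 := by
  intro h0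
  have : 0 ≤ ∑ i : Fin n, x i.castSucc * x i.castSucc :=
    Finset.sum_nonneg fun i _ => mul_self_nonneg _
  simp only [mink, h0] at h
  linarith

/-- The group `G = SO₀(n, 1)` of hyperbolic rotations: the linear maps of determinant `1` which
preserve the form `[·, ·]` and the upper sheet of the hyperboloid. -/
def hypGroup (n : ℕ) : Subgroup (Matrix (Fin (n + 1)) (Fin (n + 1)) ℝ)ˣ where
  carrier := {g | (∀ x y, mink (g.1.mulVec x) (g.1.mulVec y) = mink x y) ∧ g.1.det = 1 ∧
    ∀ x ∈ hyperboloid n, g.1.mulVec x ∈ hyperboloid n}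
  one_mem' := by simp
  mul_mem' := by
    rintro a b ⟨ha, ha', ha''⟩ ⟨hb, hb', hb''⟩
    refine ⟨fun x y => ?_, ?_, fun x hx => ?_⟩
    · simp only [Units.val_mul, ← Matrix.mulVec_mulVec, ha, hb]
    · simp [Matrix.det_mul, ha', hb']
    · simp only [Units.val_mul, ← Matrix.mulVec_mulVec]
      exact ha'' _ (hb'' _ hx)
  inv_mem' := by
    rintro g ⟨h1, h2, h3⟩
    have hg : ∀ x, g.1.mulVec (g⁻¹.1.mulVec x) = x := fun x => by
      rw [Matrix.mulVec_mulVec, Units.mul_inv, Matrix.one_mulVec]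
    have hf : ∀ x y, mink (g⁻¹.1.mulVec x) (g⁻¹.1.mulVec y) = mink x y := fun x y => by
      rw [← h1, hg, hg]
    refine ⟨hf, ?_, fun x hx => ?_⟩
    · have := congrArg Matrix.det (Units.mul_inv g)
      rw [Matrix.det_mul, h2, one_mul, Matrix.det_one] at this
      exact this
    · have hm : mink (g⁻¹.1.mulVec x) (g⁻¹.1.mulVec x) = 1 := by rw [hf]; exact hx.1
      refine ⟨hm, ?_⟩
      by_contra hneg
      have hlt := lt_of_le_of_ne (not_lt.mp hneg) (last_ne_zero hm)
      have hmem : -(g⁻¹.1.mulVec x) ∈ hyperboloid n :=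
        ⟨by simpa [mink] using hm, by simpa using hlt⟩
      have h4 := (h3 _ hmem).2
      rw [Matrix.mulVec_neg, hg] at h4
      have := hx.2
      simp only [Pi.neg_apply] at h4
      linarith

/-- The action of `G` on `ℍⁿ`. -/
instance (n : ℕ) : MulAction (hypGroup n) (Hyp n) where
  smul g x := ⟨g.1.1.mulVec x.1, g.2.2.2 _ x.2⟩
  one_smul _ := Subtype.ext (Matrix.one_mulVec _)
  mul_smul g h x := Subtype.ext (Matrix.mulVec_mulVec x.1 g.1.1 h.1.1).symm

theorem continuous_mink {α : Type*} [TopologicalSpace α] {n : ℕ} {f g : α → Fin (n + 1) → ℝ}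
    (hf : Continuous f) (hg : Continuous g) : Continuous fun a => mink (f a) (g a) := by
  unfold mink
  fun_prop

theorem isClosed_hyperboloid (n : ℕ) : IsClosed (hyperboloid n) := by
  have : hyperboloid n = {x | mink x x = 1} ∩ {x | 0 ≤ x (Fin.last n)} := by
    ext x
    exact ⟨fun h => ⟨h.1, h.2.le⟩, fun h => ⟨h.1, lt_of_le_of_ne h.2 (last_ne_zero h.1).symm⟩⟩
  rw [this]
  exact (isClosed_eq (continuous_mink continuous_id continuous_id) continuous_const).inter
    (isClosed_le continuous_const (continuous_apply _))

theorem isClosed_hypGroup (n : ℕ) :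
    IsClosed (hypGroup n : Set (Matrix (Fin (n + 1)) (Fin (n + 1)) ℝ)ˣ) := by
  have hc : ∀ x : Fin (n + 1) → ℝ,
      Continuous fun g : (Matrix (Fin (n + 1)) (Fin (n + 1)) ℝ)ˣ => g.1.mulVec x :=
    fun x => Units.continuous_val.matrix_mulVec continuous_const
  have : (hypGroup n : Set (Matrix (Fin (n + 1)) (Fin (n + 1)) ℝ)ˣ) =
      (⋂ x, ⋂ y, {g | mink (g.1.mulVec x) (g.1.mulVec y) = mink x y}) ∩ ({g | g.1.det = 1} ∩
        ⋂ x ∈ hyperboloid n, {g | g.1.mulVec x ∈ hyperboloid n}) := by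
    ext g
    simp [hypGroup]
  rw [this]
  refine IsClosed.inter ?_ (IsClosed.inter ?_ ?_)
  · exact isClosed_iInter fun x => isClosed_iInter fun y =>
      isClosed_eq (continuous_mink (hc x) (hc y)) continuous_const
  · exact isClosed_eq Units.continuous_val.matrix_det continuous_const
  · exact isClosed_biInter fun x _ => (isClosed_hyperboloid n).preimage (hc x)

instance (n : ℕ) : LocallyCompactSpace (hypGroup n) := by
  have : LocallyCompactSpace (Matrix (Fin (n + 1)) (Fin (n + 1)) ℝ) :=
    inferInstanceAs (LocallyCompactSpace (Fin (n + 1) → Fin (n + 1) → ℝ))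
  have : LocallyCompactSpace (Matrix (Fin (n + 1)) (Fin (n + 1)) ℝ)ᵐᵒᵖ :=
    MulOpposite.opHomeomorph.symm.isClosedEmbedding.locallyCompactSpace
  have h : LocallyCompactSpace (Matrix (Fin (n + 1)) (Fin (n + 1)) ℝ)ˣ :=
    Units.isClosedEmbedding_embedProduct.locallyCompactSpace
  exact (isClosed_hypGroup n).isClosedEmbedding_subtypeVal.locallyCompactSpace

instance (n : ℕ) : MeasurableSpace (hypGroup n) := borel _

instance (n : ℕ) : BorelSpace (hypGroup n) := ⟨rfl⟩

/-- The origin `ξ₀ = ℍⁿ ∩ E^{k,1} = ℍᵏ` of the space of `k`-geodesics, where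
`E^{k,1} = ℝ eₙ₋ₖ₊₁ ⊕ ⋯ ⊕ ℝ eₙ₊₁`. -/
def originSet (n k : ℕ) : Set (Hyp n) :=
  {x | ∀ i : Fin (n + 1), (i : ℕ) < n - k → x.1 i = 0}

/-- Extension by zero of a vector of `ℝᵏ⁺¹` in the first `n - k` coordinates of `ℝⁿ⁺¹`. -/
def pad {n k : ℕ} (hk : k ≤ n) (y : Fin (k + 1) → ℝ) : Fin (n + 1) → ℝ :=
  fun i => if h : n - k ≤ (i : ℕ) then y ⟨i - (n - k), by omega⟩ else 0

theorem mink_pad {n k : ℕ} (hk : k ≤ n) (x y : Fin (k + 1) → ℝ) :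
    mink (pad hk x) (pad hk y) = mink x y := by
  obtain ⟨m, rfl⟩ := Nat.exists_eq_add_of_le' hk
  simp only [mink, Fin.sum_univ_add]
  congr 1
  · congr 1
    rw [Finset.sum_eq_zero, zero_add]
    · refine Finset.sum_congr rfl fun i _ => ?_
      have h : (m + k) - k ≤ ((Fin.natAdd m i).castSucc : ℕ) := by simp
      simp only [pad, dif_pos h]
      congr 2 <;> (ext; simp)
    · intro i _
      have h : ¬ (m + k) - k ≤ ((Fin.castAdd k i).castSucc : ℕ) := by simp
      simp only [pad, dif_neg h, mul_zero]
  · have h : (m + k) - k ≤ ((Fin.last (m + k) : Fin (m + k + 1)) : ℕ) := by simp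
    simp only [pad, dif_pos h]
    congr 2 <;> (ext; simp)

theorem pad_last {n k : ℕ} (hk : k ≤ n) (y : Fin (k + 1) → ℝ) :
    pad hk y (Fin.last n) = y (Fin.last k) := by
  have h : n - k ≤ ((Fin.last n : Fin (n + 1)) : ℕ) := by simp
  simp only [pad, dif_pos h]
  congr 1
  ext
  simp only [Fin.val_last]
  omega

/-- The identification of `ℍᵏ` with `ξ₀ ⊆ ℍⁿ`. -/
def embed {n k : ℕ} (hk : k ≤ n) (y : Hyp k) : Hyp n :=
  ⟨pad hk y.1, by rw [hyperboloid, mem_ofPred_eq, mink_pad, pad_last]; exact y.2⟩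

/-- The space `Ξ` of `k`-geodesics of `ℍⁿ`, that is, of its `k`-dimensional totally geodesic
submanifolds: the sets `g ξ₀` with `g ∈ G`. -/
def Geodesic (n k : ℕ) : Type :=
  {ξ : Set (Hyp n) // ∃ g : hypGroup n, ξ = (fun x => g • x) '' originSet n k}

/-- The `k`-geodesic `g ξ₀`. -/
def Geodesic.mk {n : ℕ} (k : ℕ) (g : hypGroup n) : Geodesic n k :=
  ⟨(fun x => g • x) '' originSet n k, g, rfl⟩

/-- An arbitrary hyperbolic rotation `r_ξ ∈ G` with `r_ξ ξ₀ = ξ`. -/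
def Geodesic.rot {n k : ℕ} (ξ : Geodesic n k) : hypGroup n := ξ.2.choose

/-- The Riemannian measure `d_ξ x` of the `k`-geodesic `ξ`, as a measure on `ℍⁿ` carried by `ξ`:
the image of the Riemannian measure of `ℍᵏ = ξ₀` under the isometry `r_ξ` (it does not depend on
the choice of `r_ξ`). The Radon transform is `(R f)(ξ) = ∫ x, f x ∂(ξ.measure hk)`. -/
def Geodesic.measure {n k : ℕ} (hk : k ≤ n) (ξ : Geodesic n k) : Measure (Hyp n) :=
  (hypVolume k).map fun y => ξ.rot • embed hk y

/-- The filter of the sets that contain almost all `k`-geodesics, for the (unique up to equivalence)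
`G`-invariant measure class of the homogeneous space `Ξ`: a set of `k`-geodesics is null if and only
if its preimage under the projection `g ↦ g ξ₀` is null for the Haar measure of `G`. -/
def aeGeodesic (n k : ℕ) : Filter (Geodesic n k) :=
  (ae (Measure.haar : Measure (hypGroup n))).map (Geodesic.mk k)

end HypRadon

end

/-!
For a radial integrand the integrals over `ℍᵏ = ξ₀` and `ℍⁿ` are one-dimensional, with densities
`sinhᵏ⁻¹ ω` and `sinhⁿ⁻¹ ω`, up to constants. This decides everything except the passage
from a radial to a general function of `Lᵖ`, where the claim is only about almost all geodesics.

The height `xₙ₊₁` changes under `g` by at most the factor `2 height (g x₀)` in either direction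
(`height_smul_le`, `height_le_smul`). So for `f` in `C_μ` the Radon transform is bounded by a
multiple of `∫ sinhᵏ⁻¹ ω cosh⁻ᵘ ω dω` with `u = μ` (`MemC.integrable_geodesic`), and for
`critFun = (xₙ₊₁ᵏ⁻¹ (1 + log xₙ₊₁))⁻¹` it is infinite on every geodesic as soon as it is on `ξ₀`,
where the integrand decays like `1 / ω`. The same function serves for both sharpness claims:
it is `O(xₙ₊₁ ^ (-μ))` for all `μ ≤ k - 1`, in particular bounded, and its `p`-th power is
integrable on `ℍⁿ` when `p (k - 1) ≥ n - 1` and `1 < p < ∞`.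

For `f` in `Lᵖ`, put `F = |f|ᵖ` and average `F` over the translates `g x` with `g` in a ball
`{g : height (g x₀) ≤ R}` of `G` (`ballAvg`). The average is integrable over `ℍⁿ`. It is radial,
because `G` is unimodular, the ball is bi-invariant under the stabilizer of `x₀`, and the stabilizer
is transitive on the spheres around `x₀`. Hence it is integrable over `ξ₀` with the weight
`xₙ₊₁ⁿ⁻ᵏ`, which changes one density into the other for large `ω`; small `ω` are harmless because
the average is locally bounded (`exists_ballAvg_le`). By Tonelli, `∫ F(g y) yₙ₊₁ⁿ⁻ᵏ dy` over `ℍᵏ` is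
finite for almost all `g` (`ae_lintegral_embed_lt_top`), and with `c = (n - 1) / p`
the pointwise inequality `|f| ≤ |f|ᵖ hⁿ⁻ᵏ + h⁻ᶜ` finishes the proof, since `c > k - 1`.

Two general facts are needed. The measure of `ℍⁿ`, given in polar coordinates, is invariant under
all linear maps that preserve the form and the upper sheet, because it is a multiple of the radial
projection of the Lebesgue measure of a solid cone (`lintegral_hypVolume_eq_cone`). And `G` is
unimodular, because `g⁻¹` lies in `S g S` for the stabilizer `S` of `x₀`
(`isMulRightInvariant_haar`).
-/

noncomputable section

namespace HypRadon

/-! ### The Minkowski form and the hyperboloid -/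

section Form

variable {n : ℕ}

theorem mink_comm (x y : Fin (n + 1) → ℝ) : mink x y = mink y x := by
  simp only [mink, mul_comm]

theorem mink_add_left (x y z : Fin (n + 1) → ℝ) : mink (x + y) z = mink x z + mink y z := by
  simp only [mink, Pi.add_apply, add_mul, Finset.sum_add_distrib]
  ring

theorem mink_smul_left (c : ℝ) (x y : Fin (n + 1) → ℝ) : mink (c • x) y = c * mink x y := by
  simp only [mink, Pi.smul_apply, smul_eq_mul, mul_assoc, ← Finset.mul_sum]
  ring

theorem mink_sub_left (x y z : Fin (n + 1) → ℝ) : mink (x - y) z = mink x z - mink y z := by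
  simp only [mink, Pi.sub_apply, sub_mul, Finset.sum_sub_distrib]
  ring

theorem mink_add_right (x y z : Fin (n + 1) → ℝ) : mink x (y + z) = mink x y + mink x z := by
  rw [mink_comm, mink_add_left, mink_comm y, mink_comm z]

theorem mink_smul_right (c : ℝ) (x y : Fin (n + 1) → ℝ) : mink x (c • y) = c * mink x y := by
  rw [mink_comm, mink_smul_left, mink_comm]

theorem mink_sub_right (x y z : Fin (n + 1) → ℝ) : mink x (y - z) = mink x y - mink x z := by
  rw [mink_comm, mink_sub_left, mink_comm y, mink_comm z]

theorem mink_neg_right (x y : Fin (n + 1) → ℝ) : mink x (-y) = -mink x y := by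
  rw [← neg_one_smul ℝ y, mink_smul_right, neg_one_mul]

theorem sum_sq_of_mem {x : Fin (n + 1) → ℝ} (hx : x ∈ hyperboloid n) :
    ∑ i : Fin n, x i.castSucc ^ 2 = x (Fin.last n) ^ 2 - 1 := by
  have := hx.1
  simp only [mink] at this
  simp only [sq]
  linarith

theorem one_le_last {x : Fin (n + 1) → ℝ} (hx : x ∈ hyperboloid n) : 1 ≤ x (Fin.last n) := by
  have h0 : 0 ≤ ∑ i : Fin n, x i.castSucc ^ 2 := Finset.sum_nonneg fun i _ => sq_nonneg _
  rw [sum_sq_of_mem hx] at h0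
  nlinarith [hx.2]

theorem abs_sum_le_of_mem {x y : Fin (n + 1) → ℝ} (hx : x ∈ hyperboloid n)
    (hy : y ∈ hyperboloid n) :
    |∑ i : Fin n, x i.castSucc * y i.castSucc| ≤ x (Fin.last n) * y (Fin.last n) - 1 := by
  have h := Finset.sum_mul_sq_le_sq_mul_sq Finset.univ
    (fun i : Fin n => x i.castSucc) fun i => y i.castSucc
  rw [sum_sq_of_mem hx, sum_sq_of_mem hy] at h
  have h1 := one_le_last hx
  have h2 := one_le_last hy
  refine abs_le_of_sq_le_sq (h.trans ?_) (by nlinarith)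
  nlinarith [sq_nonneg (x (Fin.last n) - y (Fin.last n))]

theorem one_le_mink {x y : Fin (n + 1) → ℝ} (hx : x ∈ hyperboloid n) (hy : y ∈ hyperboloid n) :
    1 ≤ mink x y := by
  have := abs_le.1 (abs_sum_le_of_mem hx hy)
  simp only [mink]
  linarith

theorem mink_le_two_mul {x y : Fin (n + 1) → ℝ} (hx : x ∈ hyperboloid n)
    (hy : y ∈ hyperboloid n) : mink x y ≤ 2 * x (Fin.last n) * y (Fin.last n) := by
  have := abs_le.1 (abs_sum_le_of_mem hx hy)
  simp only [mink]
  linarith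

/-- The equality case of the reverse Cauchy–Schwarz inequality. -/
theorem eq_of_mink_le_one {x y : Fin (n + 1) → ℝ} (hx : x ∈ hyperboloid n)
    (hy : y ∈ hyperboloid n) (h1 : mink x y ≤ 1) : x = y := by
  have h := Finset.sum_mul_sq_le_sq_mul_sq Finset.univ
    (fun i : Fin n => x i.castSucc) fun i => y i.castSucc
  have hm : mink x y = 1 := le_antisymm h1 (one_le_mink hx hy)
  have hs : ∑ i : Fin n, x i.castSucc * y i.castSucc = x (Fin.last n) * y (Fin.last n) - 1 := by
    simp only [mink] at hm
    linarith
  rw [sum_sq_of_mem hx, sum_sq_of_mem hy, hs] at h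
  have hl : x (Fin.last n) - y (Fin.last n) = 0 := by
    have : (x (Fin.last n) - y (Fin.last n)) ^ 2 = 0 :=
      le_antisymm (by nlinarith) (sq_nonneg _)
    exact pow_eq_zero_iff two_ne_zero |>.1 this
  have hz : ∑ i : Fin n, (x i.castSucc - y i.castSucc) ^ 2 = 0 := by
    have e : ∀ i : Fin n, (x i.castSucc - y i.castSucc) ^ 2
        = x i.castSucc ^ 2 + y i.castSucc ^ 2 - 2 * (x i.castSucc * y i.castSucc) :=
      fun i => by ring
    simp only [e, Finset.sum_sub_distrib, Finset.sum_add_distrib, ← Finset.mul_sum,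
      sum_sq_of_mem hx, sum_sq_of_mem hy, hs]
    nlinarith
  rw [Finset.sum_eq_zero_iff_of_nonneg fun i _ => sq_nonneg _] at hz
  funext i
  refine Fin.lastCases (by linarith) (fun i => ?_) i
  have := hz i (Finset.mem_univ i)
  rw [pow_eq_zero_iff two_ne_zero] at this
  linarith

theorem mink_sub_self_neg {x y : Fin (n + 1) → ℝ} (hx : x ∈ hyperboloid n)
    (hy : y ∈ hyperboloid n) (hxy : x ≠ y) : mink (x - y) (x - y) < 0 := by
  have h : ¬mink x y ≤ 1 := fun h => hxy (eq_of_mink_le_one hx hy h)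
  rw [mink_sub_left, mink_sub_right, mink_sub_right, hx.1, hy.1, mink_comm y x]
  linarith

/-- A linear map which preserves the form and maps one point of the upper sheet into the upper
sheet preserves the upper sheet: the sheets are told apart by the sign of the form. -/
theorem mulVec_mem_hyperboloid {A : Matrix (Fin (n + 1)) (Fin (n + 1)) ℝ}
    (hA : ∀ x y, mink (A.mulVec x) (A.mulVec y) = mink x y) {x : Fin (n + 1) → ℝ}
    (hx : x ∈ hyperboloid n) (hAx : A.mulVec x ∈ hyperboloid n) :
    ∀ y ∈ hyperboloid n, A.mulVec y ∈ hyperboloid n := by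
  intro y hy
  have hm : mink (A.mulVec y) (A.mulVec y) = 1 := by rw [hA]; exact hy.1
  refine ⟨hm, ?_⟩
  by_contra hneg
  have hlt := lt_of_le_of_ne (not_lt.mp hneg) (last_ne_zero hm)
  have hmem : -(A.mulVec y) ∈ hyperboloid n := ⟨by simpa [mink] using hm, by simpa using hlt⟩
  have h1 := one_le_mink hAx hmem
  rw [mink_neg_right, hA] at h1
  linarith [one_le_mink hx hy]

/-- The vector that represents the linear form `mink v`. -/
def dualVec (v : Fin (n + 1) → ℝ) : Fin (n + 1) → ℝ :=
  Fin.snoc (α := fun _ => ℝ) (fun i => -v i.castSucc) (v (Fin.last n))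

theorem dualVec_dotProduct (v x : Fin (n + 1) → ℝ) : dualVec v ⬝ᵥ x = mink v x := by
  simp [dotProduct, dualVec, mink, Fin.sum_univ_castSucc]

/-- A matrix `A` which preserves the form has determinant `±1`, as `Aᵀ J A = J` for the Gram matrix
`J` of the form. -/
theorem abs_det_eq_one {A : Matrix (Fin (n + 1)) (Fin (n + 1)) ℝ}
    (hA : ∀ x y, mink (A.mulVec x) (A.mulVec y) = mink x y) : |A.det| = 1 := by
  set J : Matrix (Fin (n + 1)) (Fin (n + 1)) ℝ :=
    Matrix.diagonal (Fin.snoc (α := fun _ => ℝ) (fun _ => -1) 1) with hJ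
  have hJm : ∀ x y, x ⬝ᵥ J.mulVec y = mink x y := fun x y => by
    simp [hJ, dotProduct, mink, Fin.sum_univ_castSucc, Matrix.mulVec_diagonal]
  have h : A.transpose * J * A = J := by
    refine Matrix.ext_iff_mulVec.2 fun y => ?_
    refine dotProduct_eq _ _ fun x => ?_
    rw [dotProduct_comm, dotProduct_comm _ x, hJm, ← hA, ← hJm, ← Matrix.mulVec_mulVec,
      ← Matrix.mulVec_mulVec, Matrix.dotProduct_mulVec, Matrix.vecMul_transpose]
  have hJdet : J.det ≠ 0 := by
    rw [hJ, Matrix.det_diagonal, Fin.prod_univ_castSucc]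
    simp
  have h2 := congrArg Matrix.det h
  rw [Matrix.det_mul, Matrix.det_mul, Matrix.det_transpose] at h2
  have h3 : A.det ^ 2 = 1 := mul_right_cancel₀ hJdet (by linear_combination h2)
  rw [← sq_abs] at h3
  nlinarith [abs_nonneg A.det]

end Form

/-! ### Reflections, and transitivity of the group -/

section Reflections

variable {n : ℕ}

/-- The reflection `x ↦ x - 2 [v, x] / [v, v] v` in the hyperplane orthogonal to `v`. -/
def reflMat (v : Fin (n + 1) → ℝ) : Matrix (Fin (n + 1)) (Fin (n + 1)) ℝ :=
  1 + Matrix.vecMulVec ((-2 / mink v v) • v) (dualVec v)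

theorem reflMat_mulVec (v x : Fin (n + 1) → ℝ) :
    (reflMat v).mulVec x = x + (-2 / mink v v * mink v x) • v := by
  rw [reflMat, Matrix.add_mulVec, Matrix.one_mulVec, Matrix.vecMulVec_mulVec, dualVec_dotProduct]
  funext i
  simp
  ring

theorem reflMat_mulVec_of_orthogonal {v x : Fin (n + 1) → ℝ} (h : mink v x = 0) :
    (reflMat v).mulVec x = x := by
  rw [reflMat_mulVec, h, mul_zero, zero_smul, add_zero]

theorem mink_reflMat {v : Fin (n + 1) → ℝ} (hv : mink v v ≠ 0) (x y : Fin (n + 1) → ℝ) :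
    mink ((reflMat v).mulVec x) ((reflMat v).mulVec y) = mink x y := by
  simp only [reflMat_mulVec, mink_add_left, mink_add_right, mink_smul_left, mink_smul_right,
    mink_comm x v]
  field_simp
  ring

theorem det_reflMat {v : Fin (n + 1) → ℝ} (hv : mink v v ≠ 0) : (reflMat v).det = -1 := by
  rw [reflMat, Matrix.vecMulVec_eq Unit, Matrix.det_one_add_replicateCol_mul_replicateRow,
    dotProduct_smul, dualVec_dotProduct, smul_eq_mul]
  field_simp
  norm_num

theorem reflMat_sub_mulVec {x y : Fin (n + 1) → ℝ} (hx : x ∈ hyperboloid n)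
    (hy : y ∈ hyperboloid n) (hxy : x ≠ y) : (reflMat (x - y)).mulVec x = y := by
  have h := mink_sub_self_neg hx hy hxy
  have h2 : -2 / mink (x - y) (x - y) * mink (x - y) x = -1 := by
    rw [div_mul_eq_mul_div, div_eq_iff h.ne, mink_sub_left, mink_sub_left, mink_sub_right,
      mink_sub_right, hx.1, hy.1, mink_comm y x]
    ring
  rw [reflMat_mulVec, h2]
  simp

theorem exists_orthogonal (hn : 2 ≤ n) (x : Fin (n + 1) → ℝ) :
    ∃ w : Fin (n + 1) → ℝ, w (Fin.last n) = 0 ∧ mink w w < 0 ∧ mink w x = 0 := by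
  obtain ⟨a, b, hab, h⟩ : ∃ a b : ℝ, 0 < a * a + b * b ∧
      a * x (Fin.castSucc ⟨0, by omega⟩) + b * x (Fin.castSucc ⟨1, by omega⟩) = 0 := by
    by_cases h0 : x (Fin.castSucc ⟨0, by omega⟩) = 0
    · exact ⟨1, 0, by norm_num, by rw [h0]; ring⟩
    · exact ⟨-x (Fin.castSucc ⟨1, by omega⟩), x (Fin.castSucc ⟨0, by omega⟩),
        by nlinarith [mul_self_pos.2 h0, mul_self_nonneg (x (Fin.castSucc ⟨1, by omega⟩))], by ring⟩
  set w : Fin (n + 1) → ℝ := Fin.snoc (α := fun _ => ℝ)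
    (Pi.single (⟨0, by omega⟩ : Fin n) a + Pi.single (⟨1, by omega⟩ : Fin n) b) 0 with hw
  have hwy : ∀ y, mink w y = -(a * y (Fin.castSucc ⟨0, by omega⟩)
      + b * y (Fin.castSucc ⟨1, by omega⟩)) := fun y => by
    simp [mink, hw, add_mul, Finset.sum_add_distrib, Pi.single_apply]
  refine ⟨w, by simp [hw], ?_, by rw [hwy, h, neg_zero]⟩
  rw [hwy]
  simp only [hw, Fin.snoc_castSucc, Pi.add_apply, Pi.single_apply]
  simp
  linarith

/-- The element of `G` given by a form-preserving matrix of determinant `1` which maps some point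
of the upper sheet into the upper sheet. -/
def mkGroup (A : Matrix (Fin (n + 1)) (Fin (n + 1)) ℝ)
    (hA : ∀ x y, mink (A.mulVec x) (A.mulVec y) = mink x y) (hdet : A.det = 1)
    (x : Hyp n) (hx : A.mulVec x.1 ∈ hyperboloid n) : hypGroup n :=
  ⟨A.nonsingInvUnit (by rw [hdet]; exact isUnit_one), hA, hdet, mulVec_mem_hyperboloid hA x.2 hx⟩

theorem coe_smul_hyp (g : hypGroup n) (x : Hyp n) : (g • x).1 = g.1.1.mulVec x.1 := rfl

/-- A product of two reflections which maps one given point to another. The reflection in `w`, which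
corrects the determinant, fixes the first point. -/
theorem exists_smul_eq_of_orthogonal {x y : Hyp n} (hxy : x ≠ y) {w : Fin (n + 1) → ℝ}
    (hw : mink w w < 0) (hwx : mink w x.1 = 0) :
    ∃ g : hypGroup n, g • x = y ∧
      ∀ z, g.1.1.mulVec z = (reflMat (x.1 - y.1)).mulVec ((reflMat w).mulVec z) := by
  have hne : x.1 ≠ y.1 := fun h => hxy (Subtype.ext h)
  have hv := mink_sub_self_neg x.2 y.2 hne
  have e : ∀ z, (reflMat (x.1 - y.1) * reflMat w).mulVec z
      = (reflMat (x.1 - y.1)).mulVec ((reflMat w).mulVec z) :=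
    fun z => (Matrix.mulVec_mulVec _ _ _).symm
  have hx : (reflMat (x.1 - y.1) * reflMat w).mulVec x.1 = y.1 := by
    rw [e, reflMat_mulVec_of_orthogonal hwx, reflMat_sub_mulVec x.2 y.2 hne]
  refine ⟨mkGroup (reflMat (x.1 - y.1) * reflMat w) (fun a b => ?_) ?_ x
    (by rw [hx]; exact y.2), Subtype.ext hx, e⟩
  · rw [e, e, mink_reflMat hv.ne, mink_reflMat hw.ne]
  · rw [Matrix.det_mul, det_reflMat hv.ne, det_reflMat hw.ne]
    norm_num

/-- The base point `x₀ = (0, …, 0, 1)` of `ℍⁿ`. -/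
def base (n : ℕ) : Hyp n :=
  ⟨Pi.single (Fin.last n) 1, by simp [hyperboloid, mink]⟩

theorem mink_base (x : Fin (n + 1) → ℝ) : mink (base n).1 x = x (Fin.last n) := by
  simp [base, mink]

theorem height_eq_mink (x : Hyp n) : height x = mink (base n).1 x.1 := (mink_base x.1).symm

theorem one_le_height (x : Hyp n) : 1 ≤ height x := one_le_last x.2

theorem height_pos (x : Hyp n) : 0 < height x := x.2.2

theorem continuous_height : Continuous (height (n := n)) :=
  (continuous_apply _).comp continuous_subtype_val

theorem height_base : height (base n) = 1 := by simp [height, base]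

theorem exists_smul_base_eq (hn : 2 ≤ n) (x : Hyp n) : ∃ g : hypGroup n, g • base n = x := by
  by_cases h : base n = x
  · exact ⟨1, by rw [one_smul, h]⟩
  · obtain ⟨w, -, hw, hwx⟩ := exists_orthogonal hn (base n).1
    obtain ⟨g, hg, -⟩ := exists_smul_eq_of_orthogonal h hw hwx
    exact ⟨g, hg⟩

/-- The stabilizer of the base point acts transitively on the spheres around it. -/
theorem exists_stabilizer_smul_eq (hn : 2 ≤ n) {x y : Hyp n} (hxy : height x = height y) :
    ∃ s : hypGroup n, s • base n = base n ∧ s • x = y := by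
  by_cases h : x = y
  · exact ⟨1, one_smul _ _, by rw [one_smul, h]⟩
  · obtain ⟨w, hw0, hw, hwx⟩ := exists_orthogonal hn x.1
    obtain ⟨g, hg, hg'⟩ := exists_smul_eq_of_orthogonal h hw hwx
    refine ⟨g, Subtype.ext ?_, hg⟩
    have hwb : mink w (base n).1 = 0 := by rw [mink_comm, mink_base, hw0]
    have hxb : mink (x.1 - y.1) (base n).1 = 0 := by
      rw [mink_comm, mink_sub_right, ← height_eq_mink, ← height_eq_mink, hxy, sub_self]
    rw [coe_smul_hyp, hg', reflMat_mulVec_of_orthogonal hwb, reflMat_mulVec_of_orthogonal hxb]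

theorem mink_smul (g : hypGroup n) (x y : Hyp n) : mink (g • x).1 (g • y).1 = mink x.1 y.1 :=
  g.2.1 _ _

theorem height_inv_smul_base (g : hypGroup n) :
    height (g⁻¹ • base n) = height (g • base n) := by
  rw [height_eq_mink, height_eq_mink, ← mink_smul g, smul_inv_smul, mink_comm]

theorem height_smul_le (g : hypGroup n) (x : Hyp n) :
    height (g • x) ≤ 2 * height (g • base n) * height x := by
  rw [height_eq_mink, ← mink_smul g⁻¹, inv_smul_smul, ← height_inv_smul_base]
  exact mink_le_two_mul (g⁻¹ • base n).2 x.2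

theorem height_le_smul (g : hypGroup n) (x : Hyp n) :
    height x ≤ 2 * height (g • base n) * height (g • x) := by
  have := height_smul_le g⁻¹ (g • x)
  rwa [inv_smul_smul, height_inv_smul_base] at this

end Reflections

/-! ### Polar coordinates of the Lebesgue measure and of `hypVolume` -/

section Polar

open Metric

theorem lintegral_eq_lintegral_sphere {n : ℕ} (hn : 1 ≤ n) (H : EuclideanSpace ℝ (Fin n) → ℝ≥0∞)
    (hH : Measurable H) :
    ∫⁻ y, H y = ∫⁻ ζ : sphere (0 : EuclideanSpace ℝ (Fin n)) 1, (∫⁻ ρ in Ioi (0 : ℝ),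
      ENNReal.ofReal (ρ ^ (n - 1)) * H (ρ • ζ.1))
        ∂(volume : Measure (EuclideanSpace ℝ (Fin n))).toSphere := by
  have : Nonempty (Fin n) := ⟨⟨0, hn⟩⟩
  have hmp := Measure.measurePreserving_homeomorphUnitSphereProd
    (volume : Measure (EuclideanSpace ℝ (Fin n)))
  have hG : Measurable fun q : sphere (0 : EuclideanSpace ℝ (Fin n)) 1 × Ioi (0 : ℝ) =>
      H (q.2.1 • q.1.1) := by
    refine hH.comp ?_
    exact (measurable_subtype_coe.comp measurable_snd).smul
      (measurable_subtype_coe.comp measurable_fst)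
  have h1 : ∫⁻ y, H y = ∫⁻ y : ({0}ᶜ : Set (EuclideanSpace ℝ (Fin n))), H y
      ∂((volume : Measure (EuclideanSpace ℝ (Fin n))).comap (↑)) := by
    rw [lintegral_subtype_comap (measurableSet_singleton _).compl, restrict_compl_singleton]
  have h2 : ∀ y : ({0}ᶜ : Set (EuclideanSpace ℝ (Fin n))),
      H y = (fun q : sphere (0 : EuclideanSpace ℝ (Fin n)) 1 × Ioi (0 : ℝ) =>
        H (q.2.1 • q.1.1)) (homeomorphUnitSphereProd _ y) := by
    intro y
    have : ((homeomorphUnitSphereProd (EuclideanSpace ℝ (Fin n))).symm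
        (homeomorphUnitSphereProd _ y)).1 = y.1 := by rw [Homeomorph.symm_apply_apply]
    rw [homeomorphUnitSphereProd_symm_apply_coe] at this
    simp only [this]
  rw [h1, lintegral_congr h2, hmp.lintegral_comp hG, lintegral_prod _ hG.aemeasurable]
  refine lintegral_congr fun ζ => ?_
  have hζ : Measurable fun ρ : Ioi (0 : ℝ) => H (ρ.1 • ζ.1) :=
    hH.comp (measurable_subtype_coe.smul measurable_const)
  rw [Measure.volumeIoiPow, lintegral_withDensity_eq_lintegral_mul _ (by fun_prop) hζ]
  simp only [finrank_euclideanSpace, Fintype.card_fin]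
  exact lintegral_subtype_comap measurableSet_Ioi
    fun ρ : ℝ => ENNReal.ofReal (ρ ^ (n - 1)) * H (ρ • ζ.1)

/-- The point `(y, t)` of `ℝⁿ × ℝ = ℝⁿ⁺¹`. -/
def cylPt {n : ℕ} (y : EuclideanSpace ℝ (Fin n)) (t : ℝ) : Fin (n + 1) → ℝ :=
  Fin.snoc (α := fun _ => ℝ) (fun i => y i) t

theorem measurable_cylPt {n : ℕ} :
    Measurable fun q : EuclideanSpace ℝ (Fin n) × ℝ => cylPt q.1 q.2 := by
  refine measurable_pi_lambda _ fun i => ?_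
  refine Fin.lastCases ?_ (fun i => ?_) i
  · simpa [cylPt] using measurable_snd
  · simp only [cylPt, Fin.snoc_castSucc]
    fun_prop

theorem lintegral_eq_lintegral_cylPt {n : ℕ} (G : (Fin (n + 1) → ℝ) → ℝ≥0∞) (hG : Measurable G) :
    ∫⁻ x, G x = ∫⁻ y : EuclideanSpace ℝ (Fin n), ∫⁻ t : ℝ, G (cylPt y t) := by
  have h := (volume_preserving_piFinSuccAbove (fun _ : Fin (n + 1) => ℝ) (Fin.last n)).symm
  have hm : Measurable fun q : ℝ × (Fin n → ℝ) =>
      G ((MeasurableEquiv.piFinSuccAbove (fun _ : Fin (n + 1) => ℝ) (Fin.last n)).symm q) :=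
    hG.comp h.measurable
  rw [← h.lintegral_comp hG, Measure.volume_eq_prod, lintegral_prod_symm _ hm.aemeasurable,
    ← (EuclideanSpace.volume_preserving_symm_measurableEquiv_toLp (Fin n)).lintegral_comp
      hm.lintegral_prod_left']
  refine lintegral_congr fun y => lintegral_congr fun t => congrArg G ?_
  funext i
  refine Fin.lastCases ?_ (fun i => ?_) i
  · simp [cylPt, MeasurableEquiv.piFinSuccAbove, Fin.insertNthEquiv]
  · simp [cylPt, MeasurableEquiv.piFinSuccAbove, Fin.insertNthEquiv]

theorem sum_sq_sphere {n : ℕ} (ζ : sphere (0 : EuclideanSpace ℝ (Fin n)) 1) :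
    ∑ i, ζ.1 i ^ 2 = 1 := by
  have h := ζ.2
  rw [mem_sphere_zero_iff_norm, EuclideanSpace.norm_eq, Real.sqrt_eq_one] at h
  simpa [sq_abs] using h

theorem mink_cylPt {n : ℕ} (ζ : sphere (0 : EuclideanSpace ℝ (Fin n)) 1) (ρ t : ℝ) :
    mink (cylPt (ρ • ζ.1) t) (cylPt (ρ • ζ.1) t) = t ^ 2 - ρ ^ 2 := by
  have e : ∀ i : Fin n, ρ * ζ.1 i * (ρ * ζ.1 i) = ρ ^ 2 * ζ.1 i ^ 2 := fun i => by ring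
  simp only [mink, cylPt, Fin.snoc_castSucc, Fin.snoc_last, PiLp.smul_apply, smul_eq_mul, e,
    ← Finset.mul_sum, sum_sq_sphere]
  ring

theorem continuous_polar (n : ℕ) : Continuous (polar n) := by
  refine Continuous.subtype_mk (continuous_pi fun i => ?_) _
  refine Fin.lastCases ?_ (fun i => ?_) i
  · simp only [Fin.snoc_last]
    fun_prop
  · simp only [Fin.snoc_castSucc]
    fun_prop

theorem height_polar {n : ℕ} (q : ℝ × sphere (0 : EuclideanSpace ℝ (Fin n)) 1) :
    height (polar n q) = Real.cosh q.1 := by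
  simp [height, polar]

theorem lintegral_hypVolume {n : ℕ} (F : Hyp n → ℝ≥0∞) (hF : Measurable F) :
    ∫⁻ x, F x ∂hypVolume n = ∫⁻ ω in Ioi (0 : ℝ), ENNReal.ofReal (Real.sinh ω ^ (n - 1)) *
      ∫⁻ ζ, F (polar n (ω, ζ)) ∂(volume : Measure (EuclideanSpace ℝ (Fin n))).toSphere := by
  have hm : Measurable fun q => F (polar n q) := hF.comp (continuous_polar n).measurable
  rw [hypVolume, lintegral_map hF (continuous_polar n).measurable,
    lintegral_prod _ hm.aemeasurable,
    lintegral_withDensity_eq_lintegral_mul _ (by fun_prop) hm.lintegral_prod_right']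
  rfl

instance (n : ℕ) : SFinite (hypVolume n) := by
  unfold hypVolume
  infer_instance

end Polar

/-! ### Invariance of `hypVolume` -/

section Invariance

open Metric

/-- The part of the solid future cone below the hyperboloid. -/
def solidCone (n : ℕ) : Set (Fin (n + 1) → ℝ) :=
  {x | 0 < mink x x ∧ mink x x < 1 ∧ 0 < x (Fin.last n)}

/-- The radial projection of the future cone onto the hyperboloid (outside of the cone its value is
the base point). -/
def radialProj {n : ℕ} (x : Fin (n + 1) → ℝ) : Hyp n := by
  classical
  exact if h : 0 < mink x x ∧ 0 < x (Fin.last n) then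
    ⟨(Real.sqrt (mink x x))⁻¹ • x, by
      have h0 := Real.sqrt_pos.2 h.1
      refine ⟨?_, ?_⟩
      · rw [mink_smul_left, mink_smul_right, ← mul_assoc, ← mul_inv, Real.mul_self_sqrt h.1.le,
          inv_mul_cancel₀ h.1.ne']
      · exact mul_pos (inv_pos.2 h0) h.2⟩
  else base n

theorem measurable_mink {n : ℕ} : Measurable fun x : Fin (n + 1) → ℝ => mink x x :=
  (continuous_mink continuous_id continuous_id).measurable

theorem measurableSet_solidCone (n : ℕ) : MeasurableSet (solidCone n) :=
  (measurableSet_lt measurable_const measurable_mink).inter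
    ((measurableSet_lt measurable_mink measurable_const).inter
      (measurableSet_lt measurable_const (measurable_pi_apply _)))

theorem coe_radialProj {n : ℕ} {x : Fin (n + 1) → ℝ} (h : 0 < mink x x ∧ 0 < x (Fin.last n)) :
    (radialProj x).1 = (Real.sqrt (mink x x))⁻¹ • x := by
  rw [radialProj, dif_pos h]

theorem measurable_radialProj {n : ℕ} : Measurable (radialProj (n := n)) := by
  classical
  refine Measurable.subtype_mk (f := fun x => (radialProj x).1) ?_
  have : (fun x : Fin (n + 1) → ℝ => (radialProj x).1) = fun x =>
      if x ∈ {x : Fin (n + 1) → ℝ | 0 < mink x x ∧ 0 < x (Fin.last n)} then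
        (Real.sqrt (mink x x))⁻¹ • x else (base n).1 := by
    funext x
    split_ifs with h
    · exact coe_radialProj h
    · exact congrArg Subtype.val (dif_neg h)
  rw [this]
  refine Measurable.ite ?_ ?_ measurable_const
  · exact (measurableSet_lt measurable_const measurable_mink).inter
      (measurableSet_lt measurable_const (measurable_pi_apply _))
  · exact (measurable_mink.sqrt.inv).smul measurable_id

theorem hasDerivAt_tanh (x : ℝ) : HasDerivAt Real.tanh (1 / Real.cosh x ^ 2) x := by
  have h := (Real.hasDerivAt_sinh x).div (Real.hasDerivAt_cosh x) (Real.cosh_pos x).ne'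
  have e : Real.tanh = fun y => Real.sinh y / Real.cosh y := funext Real.tanh_eq_sinh_div_cosh
  rw [e]
  convert! h using 1
  congr 1
  nlinarith [Real.cosh_sq x]

theorem image_mul_tanh {t : ℝ} (ht : 0 < t) :
    (fun ω => t * Real.tanh ω) '' Ioi (0 : ℝ) = Ioo 0 t := by
  ext ρ
  constructor
  · rintro ⟨ω, hω, rfl⟩
    have h0 : 0 < Real.tanh ω := by
      rw [Real.tanh_eq_sinh_div_cosh]
      exact div_pos (Real.sinh_pos_iff.2 hω) (Real.cosh_pos ω)
    exact ⟨mul_pos ht h0, by nlinarith [Real.tanh_lt_one ω]⟩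
  · rintro ⟨h0, h1⟩
    have hd : ρ / t < 1 := (div_lt_one ht).2 h1
    have hd0 : 0 < ρ / t := div_pos h0 ht
    refine ⟨Real.artanh (ρ / t), Real.artanh_pos ⟨hd0, hd⟩, ?_⟩
    simp only
    rw [Real.tanh_artanh ⟨by linarith, hd⟩]
    field_simp

theorem cylPt_mem_and_radialProj {n : ℕ} (ζ : sphere (0 : EuclideanSpace ℝ (Fin n)) 1) {ω t : ℝ}
    (ht : 0 < t) :
    (cylPt ((t * Real.tanh ω) • ζ.1) t ∈ solidCone n ↔ t < Real.cosh ω) ∧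
      radialProj (cylPt ((t * Real.tanh ω) • ζ.1) t) = polar n (ω, ζ) := by
  have hc := Real.cosh_pos ω
  have hm : mink (cylPt ((t * Real.tanh ω) • ζ.1) t) (cylPt ((t * Real.tanh ω) • ζ.1) t)
      = (t / Real.cosh ω) ^ 2 := by
    rw [mink_cylPt, Real.tanh_eq_sinh_div_cosh]
    field_simp
    linear_combination (Real.cosh_sq ω)
  have hl : cylPt ((t * Real.tanh ω) • ζ.1) t (Fin.last n) = t := by simp [cylPt]
  have hq : 0 < t / Real.cosh ω := div_pos ht hc
  refine ⟨?_, Subtype.ext ?_⟩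
  · simp only [solidCone, mem_ofPred_eq, hm, hl]
    rw [sq_lt_one_iff₀ hq.le, div_lt_one hc]
    exact ⟨fun h => h.2.1, fun h => ⟨by positivity, h, ht⟩⟩
  · rw [coe_radialProj ⟨by rw [hm]; positivity, by rw [hl]; exact ht⟩, hm, Real.sqrt_sq hq.le]
    funext i
    refine Fin.lastCases ?_ (fun i => ?_) i
    · simp [cylPt, polar]
      field_simp
    · simp [cylPt, polar, Real.tanh_eq_sinh_div_cosh]
      field_simp

/-- The planar part of the polar coordinates of the solid cone, with the substitution
`ρ = t tanh ω`, which turns the ray through `(ρ ζ, t)` into the ray through `polar n (ω, ζ)`. -/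
theorem lintegral_solidCone_fiber {n : ℕ} (hn : 1 ≤ n) (F : Hyp n → ℝ≥0∞) (hF : Measurable F)
    (ζ : sphere (0 : EuclideanSpace ℝ (Fin n)) 1) :
    ∫⁻ ρ in Ioi (0 : ℝ), ENNReal.ofReal (ρ ^ (n - 1)) *
        ∫⁻ t : ℝ, (solidCone n).indicator (fun x => F (radialProj x)) (cylPt (ρ • ζ.1) t)
      = (n + 1 : ℝ≥0∞)⁻¹ * ∫⁻ ω in Ioi (0 : ℝ), ENNReal.ofReal (Real.sinh ω ^ (n - 1)) *
          F (polar n (ω, ζ)) := by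
  obtain ⟨G, hG⟩ : ∃ G, G = (solidCone n).indicator (fun x => F (radialProj x)) := ⟨_, rfl⟩
  have hGm : Measurable G :=
    hG ▸ (hF.comp measurable_radialProj).indicator (measurableSet_solidCone n)
  have hGc : Measurable fun q : ℝ × ℝ => G (cylPt (q.1 • ζ.1) q.2) := by
    refine hGm.comp (measurable_cylPt.comp (f := fun q : ℝ × ℝ => (q.1 • ζ.1, q.2)) ?_)
    exact (measurable_fst.smul measurable_const).prodMk measurable_snd
  have hG0 : ∀ ρ t : ℝ, t ∉ Ioi (0 : ℝ) → G (cylPt (ρ • ζ.1) t) = 0 := fun ρ t ht => by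
    rw [hG]
    refine indicator_of_notMem (fun h => ht ?_) _
    simpa [cylPt] using h.2.2
  have hG1 : ∀ ρ t : ℝ, 0 < ρ → 0 < t → t ≤ ρ → G (cylPt (ρ • ζ.1) t) = 0 := fun ρ t h0 h1 h => by
    rw [hG]
    refine indicator_of_notMem (fun h' => ?_) _
    have := h'.1
    rw [mink_cylPt] at this
    nlinarith
  have hFp : Measurable fun ω => F (polar n (ω, ζ)) :=
    hF.comp ((continuous_polar n).measurable.comp measurable_prodMk_right)
  rw [← hG]
  calc
    _ = ∫⁻ ρ in Ioi (0 : ℝ), ∫⁻ t in Ioi (0 : ℝ),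
          ENNReal.ofReal (ρ ^ (n - 1)) * G (cylPt (ρ • ζ.1) t) := by
      refine lintegral_congr fun ρ => ?_
      have hm : Measurable fun t => G (cylPt (ρ • ζ.1) t) :=
        hGc.comp (measurable_prodMk_left (x := ρ))
      rw [lintegral_const_mul _ hm, ← lintegral_indicator measurableSet_Ioi]
      congr 2 with t
      by_cases h : t ∈ Ioi (0 : ℝ)
      · rw [indicator_of_mem h]
      · rw [indicator_of_notMem h, hG0 ρ t h]
    _ = ∫⁻ t in Ioi (0 : ℝ), ∫⁻ ρ in Ioi (0 : ℝ),
          ENNReal.ofReal (ρ ^ (n - 1)) * G (cylPt (ρ • ζ.1) t) := by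
      refine lintegral_lintegral_swap (Measurable.aemeasurable ?_)
      exact (by fun_prop : Measurable fun q : ℝ × ℝ => ENNReal.ofReal (q.1 ^ (n - 1))).mul hGc
    _ = ∫⁻ t in Ioi (0 : ℝ), ∫⁻ ω in Ioi (0 : ℝ),
          (Iio (Real.cosh ω)).indicator (fun t => ENNReal.ofReal (t ^ n)) t *
          (ENNReal.ofReal (Real.tanh ω ^ (n - 1) / Real.cosh ω ^ 2) * F (polar n (ω, ζ))) := by
      refine setLIntegral_congr_fun measurableSet_Ioi fun t ht => ?_
      have ht' : 0 < t := ht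
      have h1 : ∫⁻ ρ in Ioi (0 : ℝ), ENNReal.ofReal (ρ ^ (n - 1)) * G (cylPt (ρ • ζ.1) t)
          = ∫⁻ ρ in Ioo 0 t, ENNReal.ofReal (ρ ^ (n - 1)) * G (cylPt (ρ • ζ.1) t) := by
        rw [← lintegral_indicator measurableSet_Ioi, ← lintegral_indicator measurableSet_Ioo]
        congr 1 with ρ
        by_cases h : ρ ∈ Ioo 0 t
        · rw [indicator_of_mem h, indicator_of_mem (show ρ ∈ Ioi (0 : ℝ) from h.1)]
        · rw [indicator_of_notMem h]
          by_cases h0 : ρ ∈ Ioi (0 : ℝ)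
          · rw [indicator_of_mem h0, hG1 ρ t h0 ht (not_lt.1 fun h' => h ⟨h0, h'⟩), mul_zero]
          · rw [indicator_of_notMem h0]
      rw [h1, ← image_mul_tanh ht', lintegral_image_eq_lintegral_abs_deriv_mul measurableSet_Ioi
        (fun ω _ => ((hasDerivAt_tanh ω).const_mul t).hasDerivWithinAt)
        (fun a _ b _ h => Real.tanh_injective (mul_left_cancel₀ ht'.ne' h))]
      refine setLIntegral_congr_fun measurableSet_Ioi fun ω hω => ?_
      obtain ⟨hmem, hproj⟩ := cylPt_mem_and_radialProj ζ (ω := ω) ht'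
      have hc := Real.cosh_pos ω
      have hth : 0 < Real.tanh ω := by
        rw [Real.tanh_eq_sinh_div_cosh]
        exact div_pos (Real.sinh_pos_iff.2 hω) hc
      by_cases h : t < Real.cosh ω
      · rw [hG, indicator_of_mem (hmem.2 h), hproj, indicator_of_mem (show t ∈ Iio _ from h),
          ← mul_assoc, ← mul_assoc, ← ENNReal.ofReal_mul (abs_nonneg _),
          ← ENNReal.ofReal_mul (by positivity), abs_of_pos (by positivity)]
        congr 2
        obtain ⟨m, rfl⟩ := Nat.exists_eq_add_of_le' hn
        simp only [Nat.add_sub_cancel, mul_pow, pow_succ]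
        ring
      · rw [hG, indicator_of_notMem (fun h' => h (hmem.1 h')),
          indicator_of_notMem (show t ∉ Iio _ from h), mul_zero, mul_zero, zero_mul]
    _ = ∫⁻ ω in Ioi (0 : ℝ), ∫⁻ t in Ioi (0 : ℝ),
          (Iio (Real.cosh ω)).indicator (fun t => ENNReal.ofReal (t ^ n)) t *
          (ENNReal.ofReal (Real.tanh ω ^ (n - 1) / Real.cosh ω ^ 2) * F (polar n (ω, ζ))) := by
      refine lintegral_lintegral_swap (Measurable.aemeasurable ?_)
      refine Measurable.mul ?_ (Measurable.mul ?_ (hFp.comp measurable_snd))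
      · have : (fun q : ℝ × ℝ => (Iio (Real.cosh q.2)).indicator
            (fun t => ENNReal.ofReal (t ^ n)) q.1)
            = {q : ℝ × ℝ | q.1 < Real.cosh q.2}.indicator
              fun q => ENNReal.ofReal (q.1 ^ n) := by
          funext q
          simp [indicator]
        exact this ▸ (by fun_prop : Measurable fun q : ℝ × ℝ => ENNReal.ofReal (q.1 ^ n)).indicator
          (measurableSet_lt measurable_fst (Real.measurable_cosh.comp measurable_snd))
      · have : Measurable Real.tanh :=
          (continuous_iff_continuousAt.2 fun x => (hasDerivAt_tanh x).continuousAt).measurable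
        exact ENNReal.measurable_ofReal.comp (((this.comp measurable_snd).pow_const _).div
          ((Real.measurable_cosh.comp measurable_snd).pow_const _))
    _ = _ := by
      have hm : Measurable fun ω => ENNReal.ofReal (Real.sinh ω ^ (n - 1)) * F (polar n (ω, ζ)) :=
        (by fun_prop : Measurable fun ω => ENNReal.ofReal (Real.sinh ω ^ (n - 1))).mul hFp
      rw [← lintegral_const_mul _ hm]
      refine setLIntegral_congr_fun measurableSet_Ioi fun ω hω => ?_
      have hc := Real.cosh_pos ω
      have hs : 0 < Real.sinh ω := Real.sinh_pos_iff.2 hω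
      have h1 : ∫⁻ t in Ioi (0 : ℝ), (Iio (Real.cosh ω)).indicator
          (fun t => ENNReal.ofReal (t ^ n)) t
          = ENNReal.ofReal (Real.cosh ω ^ (n + 1) / (n + 1)) := by
        rw [lintegral_indicator measurableSet_Iio, Measure.restrict_restrict measurableSet_Iio,
          Iio_inter_Ioi, restrict_Ioo_eq_restrict_Ioc,
          ← ofReal_integral_eq_lintegral_ofReal, ← intervalIntegral.integral_of_le hc.le,
          integral_pow]
        · simp
        · exact (intervalIntegral.intervalIntegrable_pow n).1
        · filter_upwards [ae_restrict_mem measurableSet_Ioc] with t ht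
          exact pow_nonneg ht.1.le _
      rw [lintegral_mul_const _ ((by fun_prop : Measurable fun t : ℝ =>
        ENNReal.ofReal (t ^ n)).indicator measurableSet_Iio), h1, ← mul_assoc, ← mul_assoc,
        ← ENNReal.ofReal_mul (by positivity)]
      congr 1
      have h2 : (n + 1 : ℝ≥0∞)⁻¹ = ENNReal.ofReal ((n + 1 : ℝ)⁻¹) := by
        rw [ENNReal.ofReal_inv_of_pos (by positivity)]
        norm_cast
      rw [h2, ← ENNReal.ofReal_mul (by positivity), Real.tanh_eq_sinh_div_cosh]
      congr 1
      obtain ⟨m, rfl⟩ := Nat.exists_eq_add_of_le' hn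
      simp only [Nat.add_sub_cancel, div_pow]
      field_simp
      ring

/-- The Riemannian measure is, up to a constant, the radial projection of the Lebesgue measure of
the solid cone. -/
theorem lintegral_hypVolume_eq_cone {n : ℕ} (hn : 1 ≤ n) (F : Hyp n → ℝ≥0∞) (hF : Measurable F) :
    ∫⁻ x in solidCone n, F (radialProj x)
      = (n + 1 : ℝ≥0∞)⁻¹ * ∫⁻ x, F x ∂hypVolume n := by
  have hGm : Measurable ((solidCone n).indicator (fun x => F (radialProj x))) :=
    (hF.comp measurable_radialProj).indicator (measurableSet_solidCone n)
  have hGc : Measurable fun q : EuclideanSpace ℝ (Fin n) × ℝ =>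
      (solidCone n).indicator (fun x => F (radialProj x)) (cylPt q.1 q.2) :=
    hGm.comp measurable_cylPt
  rw [← lintegral_indicator (measurableSet_solidCone n), lintegral_eq_lintegral_cylPt _ hGm,
    lintegral_eq_lintegral_sphere hn _ hGc.lintegral_prod_right',
    lintegral_congr (lintegral_solidCone_fiber hn F hF)]
  have hm : Measurable fun q : sphere (0 : EuclideanSpace ℝ (Fin n)) 1 × ℝ =>
      ENNReal.ofReal (Real.sinh q.2 ^ (n - 1)) * F (polar n (q.2, q.1)) :=
    (by fun_prop : Measurable fun q : sphere (0 : EuclideanSpace ℝ (Fin n)) 1 × ℝ =>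
      ENNReal.ofReal (Real.sinh q.2 ^ (n - 1))).mul
      (hF.comp ((continuous_polar n).measurable.comp measurable_swap))
  rw [lintegral_const_mul _ hm.lintegral_prod_right', lintegral_hypVolume F hF,
    lintegral_lintegral_swap hm.aemeasurable]
  congr 1
  refine lintegral_congr fun ω => ?_
  have hω : Measurable fun ζ => F (polar n (ω, ζ)) :=
    hF.comp ((continuous_polar n).measurable.comp measurable_prodMk_left)
  simp only [lintegral_const_mul _ hω]

/-- Form-preserving linear maps of the hyperboloid preserve the Riemannian measure. -/
theorem lintegral_hypVolume_comp {n : ℕ} (hn : 1 ≤ n) {A : Matrix (Fin (n + 1)) (Fin (n + 1)) ℝ}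
    (hA : ∀ x y, mink (A.mulVec x) (A.mulVec y) = mink x y) {T : Hyp n → Hyp n}
    (hT : ∀ x, (T x).1 = A.mulVec x.1) (F : Hyp n → ℝ≥0∞) (hF : Measurable F) :
    ∫⁻ x, F (T x) ∂hypVolume n = ∫⁻ x, F x ∂hypVolume n := by
  have hTc : Continuous T := by
    refine continuous_induced_rng.2 ?_
    have : Subtype.val ∘ T = fun x : Hyp n => A.mulVec x.1 := funext hT
    rw [this]
    exact continuous_const.matrix_mulVec continuous_subtype_val
  have hproj : ∀ x : Fin (n + 1) → ℝ, 0 < mink x x → 0 < x (Fin.last n) →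
      0 < (A.mulVec x) (Fin.last n) ∧ radialProj (A.mulVec x) = T (radialProj x) := by
    intro x h1 h2
    have h0 := Real.sqrt_pos.2 h1
    have e := coe_radialProj ⟨h1, h2⟩
    have e2 : (T (radialProj x)).1 = (Real.sqrt (mink x x))⁻¹ • A.mulVec x := by
      rw [hT, e, Matrix.mulVec_smul]
    have hl : 0 < (A.mulVec x) (Fin.last n) := by
      have := (T (radialProj x)).2.2
      rw [e2, Pi.smul_apply, smul_eq_mul] at this
      exact pos_of_mul_pos_right this (inv_pos.2 h0).le
    refine ⟨hl, Subtype.ext ?_⟩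
    rw [coe_radialProj ⟨by rw [hA]; exact h1, hl⟩, e2, hA]
  have hdet : A.det ≠ 0 := fun h => by
    have := abs_det_eq_one hA
    rw [h, abs_zero] at this
    exact zero_ne_one this
  have hn0 : (n + 1 : ℝ≥0∞)⁻¹ ≠ 0 :=
    ENNReal.inv_ne_zero.2 (by norm_cast; exact ENNReal.natCast_ne_top _)
  have hn1 : (n + 1 : ℝ≥0∞)⁻¹ ≠ ∞ := ENNReal.inv_ne_top.2 (by positivity)
  refine (ENNReal.mul_right_inj hn0 hn1).1 ?_
  have hFT : Measurable fun x => F (T x) := hF.comp hTc.measurable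
  have hGm : Measurable ((solidCone n).indicator (fun x => F (radialProj x))) :=
    (hF.comp measurable_radialProj).indicator (measurableSet_solidCone n)
  have hmap := Real.map_matrix_volume_pi_eq_smul_volume_pi hdet
  rw [abs_inv, abs_det_eq_one hA, inv_one, ENNReal.ofReal_one, one_smul] at hmap
  rw [← lintegral_hypVolume_eq_cone hn _ hFT, ← lintegral_hypVolume_eq_cone hn _ hF,
    ← lintegral_indicator (measurableSet_solidCone n),
    ← lintegral_indicator (measurableSet_solidCone n)]
  nth_rw 2 [← hmap]
  rw [lintegral_map hGm (LinearMap.continuous_of_finiteDimensional _).measurable]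
  refine lintegral_congr fun x => ?_
  rw [Matrix.toLin'_apply]
  by_cases hx : x ∈ solidCone n
  · obtain ⟨h1, h2⟩ := hproj x hx.1 hx.2.2
    have hAx : A.mulVec x ∈ solidCone n := ⟨by rw [hA]; exact hx.1, by rw [hA]; exact hx.2.1, h1⟩
    rw [indicator_of_mem hx, indicator_of_mem hAx, h2]
  · have hAx : A.mulVec x ∉ solidCone n := by
      rintro ⟨h1, h2, h3⟩
      rw [hA] at h1 h2
      refine hx ⟨h1, h2, ?_⟩
      by_contra hneg
      have hne : x (Fin.last n) ≠ 0 := fun h0 => by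
        have : 0 ≤ ∑ i : Fin n, x i.castSucc * x i.castSucc :=
          Finset.sum_nonneg fun i _ => mul_self_nonneg _
        simp only [mink, h0] at h1
        linarith
      have := (hproj (-x) (by simpa [mink] using h1)
        (by simpa using lt_of_le_of_ne (not_lt.1 hneg) hne)).1
      rw [Matrix.mulVec_neg, Pi.neg_apply] at this
      linarith
    rw [indicator_of_notMem hx, indicator_of_notMem hAx]

end Invariance

/-! ### The measure of a `k`-geodesic -/

section GeodesicMeasure

theorem continuous_smul_hyp (n : ℕ) :
    Continuous fun q : hypGroup n × Hyp n => q.1 • q.2 := by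
  refine continuous_induced_rng.2 ?_
  change Continuous fun q : hypGroup n × Hyp n => q.1.1.1.mulVec q.2.1
  exact (Units.continuous_val.comp (continuous_subtype_val.comp continuous_fst)).matrix_mulVec
    (continuous_subtype_val.comp continuous_snd)

theorem continuous_const_smul_hyp {n : ℕ} (g : hypGroup n) : Continuous fun x : Hyp n => g • x :=
  (continuous_smul_hyp n).comp (continuous_const.prodMk continuous_id)

theorem continuous_smul_const_hyp {n : ℕ} (x : Hyp n) : Continuous fun g : hypGroup n => g • x :=
  (continuous_smul_hyp n).comp (continuous_id.prodMk continuous_const)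

theorem continuous_embed {n k : ℕ} (hk : k ≤ n) : Continuous (embed hk) := by
  refine continuous_induced_rng.2 (continuous_pi fun i => ?_)
  by_cases h : n - k ≤ (i : ℕ)
  · have : (fun y : Hyp k => (Subtype.val ∘ embed hk) y i)
        = fun y => y.1 ⟨i - (n - k), by omega⟩ := by
      funext y
      simp [embed, pad, h]
    rw [this]
    exact (continuous_apply _).comp continuous_subtype_val
  · have : (fun y : Hyp k => (Subtype.val ∘ embed hk) y i) = fun _ => 0 := by
      funext y
      simp [embed, pad, h]
    rw [this]
    exact continuous_const

theorem height_embed {n k : ℕ} (hk : k ≤ n) (y : Hyp k) : height (embed hk y) = height y :=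
  pad_last hk y.1

/-- The last `k + 1` coordinates of a vector of `ℝⁿ⁺¹`. -/
def unpad {n k : ℕ} (hk : k ≤ n) (v : Fin (n + 1) → ℝ) : Fin (k + 1) → ℝ :=
  fun j => v ⟨j + (n - k), by omega⟩

theorem pad_unpad {n k : ℕ} (hk : k ≤ n) {v : Fin (n + 1) → ℝ}
    (hv : ∀ i : Fin (n + 1), (i : ℕ) < n - k → v i = 0) : pad hk (unpad hk v) = v := by
  funext i
  by_cases h : n - k ≤ (i : ℕ)
  · simp only [pad, dif_pos h, unpad]
    congr 1
    ext
    simp only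
    omega
  · rw [pad, dif_neg h, hv i (not_le.1 h)]

theorem pad_add {n k : ℕ} (hk : k ≤ n) (v w : Fin (k + 1) → ℝ) :
    pad hk (v + w) = pad hk v + pad hk w := by
  funext i
  simp only [pad, Pi.add_apply]
  split_ifs <;> simp

theorem pad_smul {n k : ℕ} (hk : k ≤ n) (c : ℝ) (v : Fin (k + 1) → ℝ) :
    pad hk (c • v) = c • pad hk v := by
  funext i
  simp only [pad, Pi.smul_apply]
  split_ifs <;> simp

theorem mem_hyperboloid_of_pad {n k : ℕ} (hk : k ≤ n) {v : Fin (k + 1) → ℝ}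
    (hv : pad hk v ∈ hyperboloid n) : v ∈ hyperboloid k :=
  ⟨(mink_pad hk v v).symm.trans hv.1, (pad_last hk v) ▸ hv.2⟩

theorem range_embed {n k : ℕ} (hk : k ≤ n) : range (embed hk) = originSet n k := by
  ext x
  constructor
  · rintro ⟨y, rfl⟩ i hi
    simp [embed, pad, not_le.2 hi]
  · intro hx
    have e := pad_unpad hk hx
    exact ⟨⟨unpad hk x.1, mem_hyperboloid_of_pad hk (by rw [e]; exact x.2)⟩, Subtype.ext e⟩

/-- Every vector is a difference of two positive multiples of points of the hyperboloid. -/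
theorem exists_eq_smul_sub_smul {n : ℕ} (v : Fin (n + 1) → ℝ) :
    ∃ (a b : ℝ) (x y : Hyp n), v = a • x.1 - b • y.1 := by
  obtain ⟨T, hT⟩ : ∃ T : ℝ, 0 < mink (v + T • (base n).1) (v + T • (base n).1) ∧
      0 < (v + T • (base n).1) (Fin.last n) := by
    set S := ∑ i : Fin n, v i.castSucc * v i.castSucc
    have hS : 0 ≤ S := Finset.sum_nonneg fun i _ => mul_self_nonneg _
    refine ⟨S + 1 - v (Fin.last n), ?_, ?_⟩
    · have hb : mink (base n).1 (base n).1 = 1 := (base n).2.1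
      have hv : mink v v = -S + v (Fin.last n) * v (Fin.last n) := rfl
      simp only [mink_add_left, mink_add_right, mink_smul_left, mink_smul_right, mink_base,
        mink_comm v, hb, hv]
      nlinarith
    · simp [base]
      linarith
  refine ⟨Real.sqrt (mink (v + T • (base n).1) (v + T • (base n).1)), T,
    radialProj (v + T • (base n).1), base n, ?_⟩
  rw [coe_radialProj hT, smul_inv_smul₀ (Real.sqrt_pos.2 hT.1).ne', add_sub_cancel_right]

/-- An element of `G` that maps `ξ₀` into itself induces a measure-preserving map of `ℍᵏ`. -/
theorem lintegral_embed_smul {n k : ℕ} (hk1 : 1 ≤ k) (hk : k ≤ n) {t : hypGroup n}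
    (ht : ∀ x ∈ originSet n k, t • x ∈ originSet n k) (F : Hyp n → ℝ≥0∞) (hF : Measurable F) :
    ∫⁻ y, F (t • embed hk y) ∂hypVolume k = ∫⁻ y, F (embed hk y) ∂hypVolume k := by
  set L : (Fin (k + 1) → ℝ) →ₗ[ℝ] (Fin (k + 1) → ℝ) :=
    { toFun := fun v => unpad hk (t.1.1.mulVec (pad hk v))
      map_add' := fun v w => by
        rw [pad_add, Matrix.mulVec_add]
        rfl
      map_smul' := fun c v => by
        rw [pad_smul, Matrix.mulVec_smul]
        rfl }
  have hpad : ∀ y : Hyp k, ∀ i : Fin (n + 1), (i : ℕ) < n - k →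
      t.1.1.mulVec (pad hk y.1) i = 0 := fun y =>
    ht (embed hk y) (range_embed hk ▸ mem_range_self y)
  have hL : ∀ v, pad hk (L v) = t.1.1.mulVec (pad hk v) := fun v => by
    refine pad_unpad hk (v := t.1.1.mulVec (pad hk v)) fun i hi => ?_
    obtain ⟨a, b, x, y, rfl⟩ := exists_eq_smul_sub_smul v
    rw [sub_eq_add_neg, ← neg_smul, pad_add, pad_smul, pad_smul, Matrix.mulVec_add,
      Matrix.mulVec_smul, Matrix.mulVec_smul, Pi.add_apply, Pi.smul_apply, Pi.smul_apply,
      hpad x i hi, hpad y i hi, smul_zero, smul_zero, add_zero]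
  have hLA : ∀ v, (LinearMap.toMatrix' L).mulVec v = L v := fun v => by
    rw [← Matrix.toLin'_apply, Matrix.toLin'_toMatrix']
  have hmem : ∀ y : Hyp k, L y.1 ∈ hyperboloid k := fun y =>
    mem_hyperboloid_of_pad hk (by rw [hL]; exact (t • embed hk y).2)
  have h := lintegral_hypVolume_comp hk1 (A := LinearMap.toMatrix' L) (fun v w => by
    rw [hLA, hLA, ← mink_pad hk, hL, hL, t.2.1, mink_pad]) (T := fun y => ⟨L y.1, hmem y⟩)
    (fun y => (hLA y.1).symm) (fun y => F (embed hk y)) (hF.comp (continuous_embed hk).measurable)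
  rw [← h]
  refine lintegral_congr fun y => congrArg F (Subtype.ext ?_)
  exact (hL y.1).symm

theorem lintegral_measure {n k : ℕ} (hk : k ≤ n) (ξ : Geodesic n k) (F : Hyp n → ℝ≥0∞)
    (hF : Measurable F) :
    ∫⁻ x, F x ∂(ξ.measure hk) = ∫⁻ y, F (ξ.rot • embed hk y) ∂hypVolume k := by
  exact lintegral_map hF
    ((continuous_const_smul_hyp ξ.rot).comp (continuous_embed hk)).measurable

/-- The measure of a `k`-geodesic may be computed with any parametrization `g` of it. -/
theorem lintegral_measure_mk {n k : ℕ} (hk1 : 1 ≤ k) (hk : k ≤ n) (g : hypGroup n)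
    (F : Hyp n → ℝ≥0∞) (hF : Measurable F) :
    ∫⁻ x, F x ∂((Geodesic.mk k g).measure hk) = ∫⁻ y, F (g • embed hk y) ∂hypVolume k := by
  rw [lintegral_measure hk _ F hF]
  set r := (Geodesic.mk k g).rot
  have hr : (fun x => g • x) '' originSet n k = (fun x => r • x) '' originSet n k :=
    (Geodesic.mk k g).2.choose_spec
  have ht : ∀ x ∈ originSet n k, (g⁻¹ * r) • x ∈ originSet n k := fun x hx => by
    have : r • x ∈ (fun x => g • x) '' originSet n k := hr ▸ mem_image_of_mem _ hx
    obtain ⟨z, hz, e⟩ := this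
    rw [mul_smul, ← e, inv_smul_smul]
    exact hz
  have h := lintegral_embed_smul hk1 hk ht (fun x => F (g • x))
    (hF.comp (continuous_const_smul_hyp g).measurable)
  rw [← h]
  refine lintegral_congr fun y => ?_
  rw [mul_smul, smul_inv_smul]

end GeodesicMeasure

/-! ### Haar measure of the group -/

section Group

instance (n : ℕ) : SecondCountableTopology (hypGroup n) := by
  have : SecondCountableTopology (Matrix (Fin (n + 1)) (Fin (n + 1)) ℝ) :=
    inferInstanceAs (SecondCountableTopology (Fin (n + 1) → Fin (n + 1) → ℝ))
  have : SecondCountableTopology (Matrix (Fin (n + 1)) (Fin (n + 1)) ℝ)ᵐᵒᵖ :=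
    MulOpposite.opHomeomorph.symm.isEmbedding.secondCountableTopology
  have : SecondCountableTopology (Matrix (Fin (n + 1)) (Fin (n + 1)) ℝ)ˣ :=
    Units.isEmbedding_embedProduct.secondCountableTopology
  exact TopologicalSpace.Subtype.secondCountableTopology
    (hypGroup n : Set (Matrix (Fin (n + 1)) (Fin (n + 1)) ℝ)ˣ)

/-- The ball `{g : g x₀ has height at most R}`, which is bi-invariant under the stabilizer of
`x₀`. -/
def groupBall (n : ℕ) (R : ℝ) : Set (hypGroup n) := {g | height (g • base n) ≤ R}

theorem isClosed_groupBall (n : ℕ) (R : ℝ) : IsClosed (groupBall n R) :=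
  isClosed_le (continuous_height.comp (continuous_smul_const_hyp _)) continuous_const

/-- The last row of `g` is given by the point `g⁻¹ x₀`, and the form `[·, ·]` of the other columns
is `-1`. -/
theorem abs_apply_le_of_mem_groupBall {n : ℕ} {R : ℝ} {g : hypGroup n} (hg : g ∈ groupBall n R)
    (i j : Fin (n + 1)) : |g.1.1 i j| ≤ R + 1 := by
  have hR : 1 ≤ R := (one_le_height _).trans hg
  have hcol : ∀ j, g.1.1.mulVec (Pi.single j 1) = fun i => g.1.1 i j := fun j => by
    funext i
    simp
  have hbd : ∀ x : Hyp n, height x ≤ R → ∀ i, |x.1 i| ≤ R := fun x hx i => by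
    refine Fin.lastCases ?_ (fun i => ?_) i
    · exact (abs_of_pos x.2.2).le.trans hx
    · refine abs_le_of_sq_le_sq ?_ (by linarith)
      have h1 : x.1 i.castSucc ^ 2 ≤ ∑ i : Fin n, x.1 i.castSucc ^ 2 :=
        Finset.single_le_sum (f := fun i : Fin n => x.1 i.castSucc ^ 2)
          (fun i _ => sq_nonneg _) (Finset.mem_univ i)
      rw [sum_sq_of_mem x.2] at h1
      have h2 := one_le_height x
      simp only [height] at h2 hx
      nlinarith
  have hlast : ∀ j, |g.1.1 (Fin.last n) j| ≤ R := fun j => by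
    have h1 : g.1.1 (Fin.last n) j = mink (g⁻¹ • base n).1 (Pi.single j 1) := by
      rw [← g.2.1, ← coe_smul_hyp, smul_inv_smul, mink_base, hcol]
    have h2 := hbd (g⁻¹ • base n) (by rw [height_inv_smul_base]; exact hg) j
    rw [h1]
    revert h2
    refine Fin.lastCases ?_ (fun j => ?_) j
    · simp [mink]
    · simp [mink, Pi.single_apply]
  refine Fin.lastCases (fun j => ?_) (fun i => ?_) i j
  · exact (hlast j).trans (by linarith)
  · intro j
    have h1 : mink (fun i => g.1.1 i j) (fun i => g.1.1 i j) ≥ -1 := by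
      rw [← hcol, g.2.1]
      refine Fin.lastCases ?_ (fun j => ?_) j
      · simp [mink]
      · simp [mink, Pi.single_apply]
    have h2 : g.1.1 i.castSucc j * g.1.1 i.castSucc j
        ≤ ∑ i : Fin n, g.1.1 i.castSucc j * g.1.1 i.castSucc j :=
      Finset.single_le_sum (f := fun i : Fin n => g.1.1 i.castSucc j * g.1.1 i.castSucc j)
          (fun i _ => mul_self_nonneg _) (Finset.mem_univ i)
    have h3 := sq_le_sq' (abs_le.1 (hlast j)).1 (abs_le.1 (hlast j)).2
    simp only [mink] at h1
    refine abs_le_of_sq_le_sq ?_ (by linarith)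
    nlinarith

theorem isCompact_groupBall (n : ℕ) (R : ℝ) : IsCompact (groupBall n R) := by
  have hK : IsCompact (Set.pi univ fun _ : Fin (n + 1) => Set.pi univ fun _ : Fin (n + 1) =>
      Icc (-(R + 1)) (R + 1) : Set (Matrix (Fin (n + 1)) (Fin (n + 1)) ℝ)) :=
    isCompact_univ_pi fun _ => isCompact_univ_pi fun _ => isCompact_Icc
  have hK2 := hK.prod (hK.image MulOpposite.continuous_op)
  have hemb := (Units.isClosedEmbedding_embedProduct
    (α := Matrix (Fin (n + 1)) (Fin (n + 1)) ℝ)).comp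
    (isClosed_hypGroup n).isClosedEmbedding_subtypeVal
  refine (hemb.isCompact_preimage hK2).of_isClosed_subset (isClosed_groupBall n R)
    fun (g : hypGroup n) hg => ?_
  have hg' : g⁻¹ ∈ groupBall n R := (height_inv_smul_base g).trans_le hg
  exact ⟨fun i _ j _ => abs_le.1 (abs_apply_le_of_mem_groupBall hg i j),
    _, fun i _ j _ => abs_le.1 (abs_apply_le_of_mem_groupBall hg' i j), rfl⟩

theorem measure_groupBall_lt_top (n : ℕ) (R : ℝ) :
    (Measure.haar : Measure (hypGroup n)) (groupBall n R) < ∞ :=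
  (isCompact_groupBall n R).measure_lt_top

theorem measure_groupBall_pos (n : ℕ) {R : ℝ} (hR : 1 < R) :
    0 < (Measure.haar : Measure (hypGroup n)) (groupBall n R) := by
  have ho : IsOpen {g : hypGroup n | height (g • base n) < R} :=
    isOpen_lt (continuous_height.comp (continuous_smul_const_hyp _)) continuous_const
  refine (ho.measure_pos Measure.haar ⟨1, ?_⟩).trans_le (measure_mono fun g hg =>
    le_of_lt (show height (g • base n) < R from hg))
  rw [mem_ofPred_eq, one_smul, height_base]
  exact hR

/-- The group `G` is unimodular. The modular character is trivial on the stabilizer `S` of the base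
point, as `U S = U` for a ball `U`; and every `g⁻¹` is in `S g S`, as `g⁻¹ x₀` and `g x₀` have the
same height. -/
theorem isMulRightInvariant_haar {n : ℕ} (hn : 2 ≤ n) :
    (Measure.haar : Measure (hypGroup n)).IsMulRightInvariant := by
  have hmap : ∀ g : hypGroup n, Measure.map (· * g) (Measure.haar : Measure (hypGroup n))
      = Measure.modularCharacterFun g • (Measure.haar : Measure (hypGroup n)) :=
    Measure.map_right_mul_eq_modularCharacterFun_smul _
  have hS : ∀ s : hypGroup n, s • base n = base n → Measure.modularCharacterFun s = 1 := by
    intro s hs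
    have h := congrArg (fun μ => μ (groupBall n 2)) (hmap s)
    rw [Measure.map_apply (measurable_mul_const s) (isClosed_groupBall n 2).measurableSet,
      Measure.smul_apply] at h
    have hpre : (· * s) ⁻¹' groupBall n 2 = groupBall n 2 := by
      ext g
      simp only [groupBall, mem_preimage, mem_ofPred_eq, mul_smul, hs]
    rw [hpre, ENNReal.smul_def, smul_eq_mul] at h
    have h0 := (measure_groupBall_pos n one_lt_two).ne'
    have h1 := (measure_groupBall_lt_top n 2).ne
    have h2 : ((Measure.modularCharacterFun s : NNReal) : ℝ≥0∞) = 1 :=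
      (ENNReal.mul_left_inj h0 h1).1 (by rw [one_mul]; exact h.symm)
    exact_mod_cast h2
  refine ⟨fun g => ?_⟩
  obtain ⟨s, hs, hsg⟩ := exists_stabilizer_smul_eq hn (height_inv_smul_base g).symm
  have hs' : (g * s * g) • base n = base n := by
    rw [mul_smul, mul_smul, hsg, smul_inv_smul]
  have h := hS _ hs'
  rw [Measure.modularCharacterFun_map_mul, Measure.modularCharacterFun_map_mul, hS s hs, mul_one,
    ← sq] at h
  rw [hmap, (pow_eq_one_iff_of_nonneg zero_le two_ne_zero).1 h, one_smul]

end Group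

/-! ### Integrals of functions of the height -/

section Height

open Metric Real

/-- The total mass of the unit sphere of `ℝᵏ`. -/
def sphereMass (k : ℕ) : ℝ≥0∞ := (volume : Measure (EuclideanSpace ℝ (Fin k))).toSphere univ

theorem sphereMass_ne_top (k : ℕ) : sphereMass k ≠ ∞ := measure_ne_top _ _

theorem sphereMass_ne_zero {k : ℕ} (hk : 1 ≤ k) : sphereMass k ≠ 0 := by
  have : Nonempty (Fin k) := ⟨⟨0, hk⟩⟩
  exact Measure.measure_univ_ne_zero.2 (Measure.toSphere_ne_zero _)

/-- The integral of a function that is constant on the spheres around the base point. -/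
theorem lintegral_radial {k : ℕ} (F : Hyp k → ℝ≥0∞) (hF : Measurable F) (m : ℝ → ℝ≥0∞)
    (h : ∀ q, 0 < q.1 → F (polar k q) = m q.1) :
    ∫⁻ x, F x ∂hypVolume k
      = (∫⁻ ω in Ioi (0 : ℝ), ENNReal.ofReal (sinh ω ^ (k - 1)) * m ω) * sphereMass k := by
  rw [lintegral_hypVolume F hF, ← lintegral_mul_const' _ _ (sphereMass_ne_top k)]
  refine setLIntegral_congr_fun measurableSet_Ioi fun ω hω => ?_
  have e : ∀ ζ, F (polar k (ω, ζ)) = m ω := fun ζ => h (ω, ζ) hω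
  simp only [e, lintegral_const, sphereMass, mul_assoc]

theorem half_exp_le_cosh (ω : ℝ) : exp ω / 2 ≤ cosh ω := by
  rw [cosh_eq]
  linarith [exp_pos (-ω)]

theorem cosh_le_exp {ω : ℝ} (hω : 0 ≤ ω) : cosh ω ≤ exp ω := by
  rw [cosh_eq]
  have : exp (-ω) ≤ exp ω := exp_le_exp.2 (by linarith)
  linarith

theorem cosh_le_two_mul_sinh {ω : ℝ} (hω : 1 ≤ ω) : cosh ω ≤ 2 * sinh ω := by
  have h1 : 3 ≤ exp (2 * ω) := by linarith [add_one_le_exp (2 * ω)]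
  have h2 : exp (2 * ω) * exp (-ω) = exp ω := by
    rw [← exp_add]
    ring_nf
  have h3 := mul_le_mul_of_nonneg_right h1 (exp_pos (-ω)).le
  rw [h2] at h3
  rw [cosh_eq, sinh_eq]
  linarith

theorem sinh_le_cosh (ω : ℝ) : sinh ω ≤ cosh ω := (sinh_lt_cosh ω).le

theorem lintegral_height_rpow_lt_top {k : ℕ} (hk : 1 ≤ k) {c : ℝ} (hc : (k : ℝ) - 1 < c) :
    ∫⁻ y : Hyp k, ENNReal.ofReal (height y ^ (-c)) ∂hypVolume k < ∞ := by
  have hm : Measurable fun y : Hyp k => ENNReal.ofReal (height y ^ (-c)) :=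
    (continuous_height.measurable.pow_const _).ennreal_ofReal
  rw [lintegral_radial _ hm (fun ω => ENNReal.ofReal (cosh ω ^ (-c)))
    (fun q _ => by rw [height_polar])]
  refine ENNReal.mul_lt_top ?_ (sphereMass_ne_top k).lt_top
  -- The integrand decays like `exp (-δ ω)`.
  set δ := c - ((k : ℝ) - 1) with hδ
  have hδ0 : 0 < δ := by linarith
  have hint : IntegrableOn (fun ω => 2 ^ δ * exp (-δ * ω)) (Ioi 0) :=
    (exp_neg_integrableOn_Ioi 0 hδ0).const_mul _
  refine lt_of_le_of_lt (setLIntegral_mono_ae (by fun_prop) (ae_of_all _ fun ω hω => ?_))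
    hint.lintegral_lt_top
  have hs : 0 < sinh ω := sinh_pos_iff.2 hω
  have hcp := cosh_pos ω
  rw [← ENNReal.ofReal_mul (by positivity)]
  refine ENNReal.ofReal_le_ofReal ?_
  calc sinh ω ^ (k - 1) * cosh ω ^ (-c) ≤ cosh ω ^ (k - 1) * cosh ω ^ (-c) := by
        have := sinh_le_cosh ω
        gcongr
    _ = cosh ω ^ (-δ) := by
        rw [← rpow_natCast, ← rpow_add hcp, Nat.cast_sub hk, Nat.cast_one, hδ]
        congr 1
        ring
    _ ≤ (exp ω / 2) ^ (-δ) :=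
        rpow_le_rpow_of_nonpos (by positivity) (half_exp_le_cosh ω) (by linarith)
    _ = 2 ^ δ * exp (-δ * ω) := by
        rw [div_rpow (exp_pos _).le zero_le_two, rpow_neg zero_le_two, div_inv_eq_mul, mul_comm,
          ← exp_mul, mul_comm ω]

/-- The function `xₙ₊₁ ^ (1 - k) (1 + log xₙ₊₁)⁻¹`, whose Radon transform is infinite on every
`k`-geodesic. -/
def critFun (n k : ℕ) (x : Hyp n) : ℝ := (height x ^ (k - 1) * (1 + log (height x)))⁻¹

theorem log_height_nonneg {n : ℕ} (x : Hyp n) : 0 ≤ log (height x) := log_nonneg (one_le_height x)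

theorem critFun_pos (n k : ℕ) (x : Hyp n) : 0 < critFun n k x := by
  have := log_height_nonneg x
  have := height_pos x
  unfold critFun
  positivity

theorem continuous_critFun (n k : ℕ) : Continuous (critFun n k) := by
  refine Continuous.inv₀ ?_ fun x => ?_
  · exact (continuous_height.pow _).mul
      (continuous_const.add (continuous_height.log fun x => (height_pos x).ne'))
  · exact fun h => (critFun_pos n k x).ne' (by rw [critFun, h, inv_zero])

theorem critFun_le_rpow {n k : ℕ} (hk : 1 ≤ k) {μ : ℝ} (hμ : μ ≤ (k : ℝ) - 1) (x : Hyp n) :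
    critFun n k x ≤ height x ^ (-μ) := by
  have h1 := one_le_height x
  have h2 := log_height_nonneg x
  rw [critFun, rpow_neg (height_pos x).le]
  refine inv_anti₀ (rpow_pos_of_pos (height_pos x) _) ?_
  calc height x ^ μ ≤ height x ^ ((k : ℝ) - 1) := rpow_le_rpow_of_exponent_le h1 hμ
    _ = height x ^ (k - 1) := by rw [← rpow_natCast, Nat.cast_sub hk, Nat.cast_one]
    _ ≤ height x ^ (k - 1) * (1 + log (height x)) :=
        le_mul_of_one_le_right (by positivity) (by linarith)

theorem memC_critFun {n k : ℕ} (hk : 1 ≤ k) {μ : ℝ} (hμ : μ ≤ (k : ℝ) - 1) :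
    MemC μ (critFun n k) := by
  refine ⟨continuous_critFun n k, Asymptotics.IsBigO.of_bound 1 (.of_forall fun x => ?_)⟩
  rw [one_mul, norm_of_nonneg (critFun_pos n k x).le,
    norm_of_nonneg (rpow_nonneg (height_pos x).le _)]
  exact critFun_le_rpow hk hμ x

theorem lintegral_critFun_eq_top {k : ℕ} (hk : 1 ≤ k) :
    ∫⁻ y, ENNReal.ofReal (critFun k k y) ∂hypVolume k = ∞ := by
  rw [lintegral_radial _ (continuous_critFun k k).measurable.ennreal_ofReal
    (fun ω => ENNReal.ofReal ((cosh ω ^ (k - 1) * (1 + log (cosh ω)))⁻¹))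
    (fun q _ => by rw [critFun, height_polar])]
  refine ENNReal.mul_eq_top.2 (Or.inr ⟨?_, sphereMass_ne_zero hk⟩)
  by_contra hne
  -- On `(1, ∞)` the integrand is at least `2 ^ (-k) / ω`.
  refine not_integrableOn_Ioi_inv (a := (1 : ℝ)) ?_
  have hmeas : AEStronglyMeasurable (fun ω : ℝ => ω⁻¹) (volume.restrict (Ioi 1)) :=
    measurable_inv.aestronglyMeasurable
  refine ⟨hmeas, ?_⟩
  have hle : ∫⁻ ω in Ioi (1 : ℝ), ‖ω⁻¹‖ₑ ≤ ENNReal.ofReal (2 ^ k) *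
      ∫⁻ ω in Ioi (0 : ℝ), ENNReal.ofReal (sinh ω ^ (k - 1)) *
        ENNReal.ofReal ((cosh ω ^ (k - 1) * (1 + log (cosh ω)))⁻¹) := by
    rw [← lintegral_const_mul' _ _ ENNReal.ofReal_ne_top]
    refine le_trans ?_ (lintegral_mono_set (Ioi_subset_Ioi (zero_le_one' ℝ)))
    refine setLIntegral_mono' measurableSet_Ioi fun ω hω => ?_
    have hω1 : 1 < ω := hω
    have hω0 : 0 < ω := by linarith
    have hs : 0 < sinh ω := sinh_pos_iff.2 hω0
    have hlog : log (cosh ω) ≤ ω := (log_le_iff_le_exp (cosh_pos ω)).2 (cosh_le_exp hω0.le)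
    have hlog0 : 0 ≤ log (cosh ω) := log_nonneg (one_le_cosh ω)
    have hcp := cosh_pos ω
    rw [enorm_of_nonneg (inv_pos.2 hω0).le, ← ENNReal.ofReal_mul (by positivity),
      ← ENNReal.ofReal_mul (by positivity)]
    refine ENNReal.ofReal_le_ofReal ?_
    have h1 : cosh ω ^ (k - 1) ≤ 2 ^ (k - 1) * sinh ω ^ (k - 1) := by
      rw [← mul_pow]
      exact pow_le_pow_left₀ hcp.le (cosh_le_two_mul_sinh hω1.le) _
    have h2 : (2 : ℝ) ^ k = 2 ^ (k - 1) * 2 := by rw [← pow_succ, Nat.sub_add_cancel hk]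
    rw [← mul_assoc, ← div_eq_mul_inv, le_div_iff₀ (by positivity), inv_mul_le_iff₀ hω0, h2]
    calc cosh ω ^ (k - 1) * (1 + log (cosh ω))
        ≤ (2 ^ (k - 1) * sinh ω ^ (k - 1)) * (2 * ω) := by
          gcongr
          linarith
      _ = ω * (2 ^ (k - 1) * 2 * sinh ω ^ (k - 1)) := by ring
  exact hle.trans_lt (ENNReal.mul_lt_top ENNReal.ofReal_lt_top (lt_top_iff_ne_top.2 hne))

theorem critFun_smul_ge {n k : ℕ} (g : hypGroup n) (x : Hyp n) :
    ((2 * height (g • base n)) ^ (k - 1) * (1 + log (2 * height (g • base n))))⁻¹ *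
      critFun n k x ≤ critFun n k (g • x) := by
  set A := 2 * height (g • base n) with hA
  have hA1 : 1 ≤ A := by linarith [one_le_height (g • base n)]
  have hlA : 0 ≤ log A := log_nonneg hA1
  have hl := log_height_nonneg x
  have hl' := log_height_nonneg (g • x)
  have hh := height_pos x
  have hh' := height_pos (g • x)
  have hle : height (g • x) ≤ A * height x := height_smul_le g x
  have hlog : log (height (g • x)) ≤ log A + log (height x) := by
    rw [← log_mul (by positivity) hh.ne']
    exact log_le_log hh' hle
  rw [critFun, critFun, ← mul_inv]
  refine inv_anti₀ (by positivity) ?_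
  calc height (g • x) ^ (k - 1) * (1 + log (height (g • x)))
      ≤ (A * height x) ^ (k - 1) * ((1 + log A) * (1 + log (height x))) := by
        gcongr
        nlinarith
    _ = A ^ (k - 1) * (1 + log A) * (height x ^ (k - 1) * (1 + log (height x))) := by ring

theorem lintegral_critFun_geodesic {n k : ℕ} (hk1 : 1 ≤ k) (hk : k ≤ n) (ξ : Geodesic n k) :
    ∫⁻ x, ENNReal.ofReal (critFun n k x) ∂(ξ.measure hk) = ∞ := by
  rw [lintegral_measure hk ξ _ (continuous_critFun n k).measurable.ennreal_ofReal]
  set B := ((2 * height (ξ.rot • base n)) ^ (k - 1) * (1 + log (2 * height (ξ.rot • base n))))⁻¹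
    with hB
  have hB0 : 0 < B := by
    have h1 := one_le_height (ξ.rot • base n)
    have : 0 ≤ log (2 * height (ξ.rot • base n)) := log_nonneg (by linarith)
    positivity
  refine top_unique ?_
  calc ∞ = ENNReal.ofReal B * ∫⁻ y, ENNReal.ofReal (critFun k k y) ∂hypVolume k := by
        rw [lintegral_critFun_eq_top hk1, ENNReal.mul_top (ENNReal.ofReal_pos.2 hB0).ne']
    _ = ∫⁻ y, ENNReal.ofReal (B * critFun k k y) ∂hypVolume k := by
        rw [← lintegral_const_mul' _ _ ENNReal.ofReal_ne_top]
        simp only [ENNReal.ofReal_mul hB0.le]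
    _ ≤ _ := lintegral_mono fun y => ENNReal.ofReal_le_ofReal (by
        have h := critFun_smul_ge (k := k) ξ.rot (embed hk y)
        have e : critFun n k (embed hk y) = critFun k k y := by
          rw [critFun, critFun, height_embed]
        rwa [e] at h)

theorem memLp_critFun {n k : ℕ} (hk : 1 ≤ k) (hkn : k < n) {p : ℝ≥0∞}
    (hp : ((n - 1 : ℕ) : ℝ≥0∞) / ((k - 1 : ℕ) : ℝ≥0∞) ≤ p) :
    MemLp (critFun n k) p (hypVolume n) := by
  have hmeas : AEStronglyMeasurable (critFun n k) (hypVolume n) :=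
    (continuous_critFun n k).aestronglyMeasurable
  by_cases hpt : p = ∞
  · subst hpt
    refine memLp_top_of_bound hmeas 1 (ae_of_all _ fun x => ?_)
    have h := critFun_le_rpow (n := n) hk (μ := 0) (by
      have : (1 : ℝ) ≤ k := by exact_mod_cast hk
      linarith) x
    rwa [neg_zero, rpow_zero, ← norm_of_nonneg (critFun_pos n k x).le] at h
  have hk0 : k - 1 ≠ 0 := fun h => hpt (top_unique (by
    rw [h, Nat.cast_zero, ENNReal.div_zero (by
      rw [Nat.cast_ne_zero]
      omega)] at hp
    exact hp))
  set P := p.toReal with hP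
  have hle : ((n - 1 : ℕ) : ℝ) ≤ (k - 1 : ℕ) * P := by
    have h := (ENNReal.div_le_iff_le_mul (Or.inl (by exact_mod_cast hk0))
      (Or.inl (ENNReal.natCast_ne_top _))).1 hp
    have := ENNReal.toReal_mono (ENNReal.mul_ne_top hpt (ENNReal.natCast_ne_top _)) h
    rw [ENNReal.toReal_mul, ENNReal.toReal_natCast, ENNReal.toReal_natCast] at this
    linarith
  have hP1 : 1 < P := by
    have h1 : ((k - 1 : ℕ) : ℝ) < (n - 1 : ℕ) := by
      exact_mod_cast (by omega : k - 1 < n - 1)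
    have h2 : (0 : ℝ) < (k - 1 : ℕ) := by exact_mod_cast Nat.pos_of_ne_zero hk0
    by_contra hcon
    nlinarith
  have hp0 : p ≠ 0 := fun h => by
    rw [hP, h, ENNReal.toReal_zero] at hP1
    linarith
  refine ⟨hmeas, (eLpNorm_lt_top_iff_lintegral_rpow_enorm_lt_top hp0 hpt).2 ?_⟩
  have e : ∀ x, ‖critFun n k x‖ₑ ^ p.toReal = ENNReal.ofReal (critFun n k x ^ P) := fun x => by
    rw [enorm_of_nonneg (critFun_pos n k x).le,
      ENNReal.ofReal_rpow_of_nonneg (critFun_pos n k x).le (by linarith)]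
  simp only [e]
  have hm : Measurable fun x => ENNReal.ofReal (critFun n k x ^ P) :=
    ((continuous_critFun n k).measurable.pow_const _).ennreal_ofReal
  rw [lintegral_radial _ hm
    (fun ω => ENNReal.ofReal ((cosh ω ^ (k - 1) * (1 + log (cosh ω)))⁻¹ ^ P))
    (fun q _ => by rw [critFun, height_polar])]
  refine ENNReal.mul_lt_top ?_ (sphereMass_ne_top n).lt_top
  have hl2 : log 2 < 1 := by linarith [log_two_lt_d9]
  have hint : IntegrableOn (fun ω => (ω + (1 - log 2)) ^ (-P)) (Ioi 0) :=
    integrableOn_add_rpow_Ioi_of_lt (by linarith) (by linarith)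
  refine lt_of_le_of_lt (setLIntegral_mono' measurableSet_Ioi fun ω hω => ?_)
    hint.lintegral_lt_top
  have hω0 : 0 < ω := hω
  have hs : 0 < sinh ω := sinh_pos_iff.2 hω
  have hcp := cosh_pos ω
  have hlog : ω - log 2 ≤ log (cosh ω) := by
    have h := log_le_log (by positivity) (half_exp_le_cosh ω)
    rwa [log_div (exp_pos _).ne' two_ne_zero, log_exp] at h
  have hlog0 : 0 ≤ log (cosh ω) := log_nonneg (one_le_cosh ω)
  rw [← ENNReal.ofReal_mul (by positivity)]
  refine ENNReal.ofReal_le_ofReal ?_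
  have h1 : sinh ω ^ (n - 1) ≤ (cosh ω ^ (k - 1)) ^ P := by
    calc sinh ω ^ (n - 1) ≤ cosh ω ^ (n - 1) := by
          have := sinh_le_cosh ω
          gcongr
      _ = cosh ω ^ ((n - 1 : ℕ) : ℝ) := (rpow_natCast _ _).symm
      _ ≤ cosh ω ^ (((k - 1 : ℕ) : ℝ) * P) :=
          rpow_le_rpow_of_exponent_le (one_le_cosh ω) hle
      _ = (cosh ω ^ (k - 1)) ^ P := by rw [rpow_mul hcp.le, rpow_natCast]
  have hc0 : 0 < (cosh ω ^ (k - 1)) ^ P := by positivity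
  calc sinh ω ^ (n - 1) * (cosh ω ^ (k - 1) * (1 + log (cosh ω)))⁻¹ ^ P
      = sinh ω ^ (n - 1) / (cosh ω ^ (k - 1)) ^ P * (1 + log (cosh ω)) ^ (-P) := by
        rw [mul_inv, mul_rpow (by positivity) (by positivity), inv_rpow (by positivity),
          inv_rpow (by positivity), rpow_neg (by positivity)]
        ring
    _ ≤ 1 * (1 + log (cosh ω)) ^ (-P) := by
        gcongr
        exact (div_le_one hc0).2 h1
    _ ≤ (ω + (1 - log 2)) ^ (-P) := by
        rw [one_mul]
        exact rpow_le_rpow_of_nonpos (by linarith) (by linarith) (by linarith)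

/-- A function of the class `C_μ` is bounded by a multiple of `xₙ₊₁ ^ (-μ)` everywhere. -/
theorem MemC.exists_bound {𝕜 : Type*} [NormedAddCommGroup 𝕜] {n : ℕ} {μ : ℝ} {f : Hyp n → 𝕜}
    (hf : MemC μ f) : ∃ C, 0 ≤ C ∧ ∀ x, ‖f x‖ ≤ C * height x ^ (-μ) := by
  obtain ⟨c, hc⟩ := hf.2.bound
  obtain ⟨K, hK, hKc⟩ := Filter.mem_cocompact.1 hc
  have hcont : Continuous fun x : Hyp n => ‖f x‖ * height x ^ μ :=
    hf.1.norm.mul (continuous_height.rpow_const fun x => Or.inl (height_pos x).ne')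
  obtain ⟨B, hB⟩ := hK.bddAbove_image hcont.continuousOn
  refine ⟨max (max c B) 0, le_max_right _ _, fun x => ?_⟩
  have hh := rpow_pos_of_pos (height_pos x) (-μ)
  by_cases hx : x ∈ K
  · have h : ‖f x‖ * height x ^ μ ≤ B := hB (mem_image_of_mem _ hx)
    have e : ‖f x‖ = ‖f x‖ * height x ^ μ * height x ^ (-μ) := by
      rw [mul_assoc, ← rpow_add (height_pos x), add_neg_cancel, rpow_zero, mul_one]
    rw [e]
    gcongr
    exact h.trans ((le_max_right _ _).trans (le_max_left _ _))
  · have h : ‖f x‖ ≤ c * ‖height x ^ (-μ)‖ := hKc hx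
    rw [norm_of_nonneg hh.le] at h
    refine h.trans ?_
    gcongr
    exact (le_max_left _ _).trans (le_max_left _ _)

theorem MemC.integrable_geodesic {𝕜 : Type*} [RCLike 𝕜] {n k : ℕ} (hk1 : 1 ≤ k) (hk : k ≤ n)
    {μ : ℝ} (hμ : (k : ℝ) - 1 < μ) {f : Hyp n → 𝕜} (hf : MemC μ f) (ξ : Geodesic n k) :
    Integrable f (ξ.measure hk) := by
  obtain ⟨C, hC, hb⟩ := hf.exists_bound
  have hμ0 : 0 < μ := by
    have : (1 : ℝ) ≤ k := by exact_mod_cast hk1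
    linarith
  refine ⟨hf.1.aestronglyMeasurable, ?_⟩
  rw [HasFiniteIntegral, lintegral_measure hk ξ _ hf.1.measurable.enorm]
  set A := 2 * height (ξ.rot • base n)
  have hA : 0 < A := by linarith [height_pos (ξ.rot • base n)]
  calc ∫⁻ y, ‖f (ξ.rot • embed hk y)‖ₑ ∂hypVolume k
      ≤ ∫⁻ y, ENNReal.ofReal (C * A ^ μ) * ENNReal.ofReal (height y ^ (-μ)) ∂hypVolume k := by
        refine lintegral_mono fun y => ?_
        rw [← ENNReal.ofReal_mul (by positivity), ← ofReal_norm]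
        refine ENNReal.ofReal_le_ofReal ((hb _).trans ?_)
        rw [mul_assoc]
        gcongr
        have h := height_le_smul ξ.rot (embed hk y)
        rw [height_embed] at h
        have h0 := height_pos (ξ.rot • embed hk y)
        have hy := height_pos y
        calc height (ξ.rot • embed hk y) ^ (-μ) ≤ (height y / A) ^ (-μ) :=
              rpow_le_rpow_of_nonpos (by positivity) ((div_le_iff₀' hA).2 h) (by linarith)
          _ = A ^ μ * height y ^ (-μ) := by
              rw [div_rpow hy.le hA.le, rpow_neg hA.le, div_inv_eq_mul, mul_comm]
    _ < ∞ := by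
        rw [lintegral_const_mul' _ _ ENNReal.ofReal_ne_top]
        exact ENNReal.mul_lt_top ENNReal.ofReal_lt_top (lintegral_height_rpow_lt_top hk1 hμ)

end Height

/-! ### Averages over balls of the group -/

section Averages

open Metric Real

/-- The average (not normalized) of `F` over the translates `g x` with `g` in a ball of `G`. -/
def ballAvg {n : ℕ} (R : ℝ) (F : Hyp n → ℝ≥0∞) (x : Hyp n) : ℝ≥0∞ :=
  ∫⁻ g in groupBall n R, F (g • x) ∂Measure.haar

variable {n : ℕ} {F : Hyp n → ℝ≥0∞}

theorem measurable_smul_hyp (hF : Measurable F) :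
    Measurable fun q : hypGroup n × Hyp n => F (q.1 • q.2) :=
  hF.comp (continuous_smul_hyp n).measurable

theorem measurable_ballAvg (hF : Measurable F) (R : ℝ) : Measurable (ballAvg R F) :=
  (measurable_smul_hyp hF).lintegral_prod_left'

theorem lintegral_smul (hn : 1 ≤ n) (hF : Measurable F) (g : hypGroup n) :
    ∫⁻ x, F (g • x) ∂hypVolume n = ∫⁻ x, F x ∂hypVolume n :=
  lintegral_hypVolume_comp hn g.2.1 (coe_smul_hyp g) F hF

theorem lintegral_ballAvg_lt_top (hn : 1 ≤ n) (hF : Measurable F)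
    (hfin : ∫⁻ x, F x ∂hypVolume n < ∞) (R : ℝ) : ∫⁻ x, ballAvg R F x ∂hypVolume n < ∞ := by
  have h : ∫⁻ x, ballAvg R F x ∂hypVolume n
      = ∫⁻ g in groupBall n R, ∫⁻ x, F (g • x) ∂hypVolume n ∂Measure.haar :=
    (lintegral_lintegral_swap (measurable_smul_hyp hF).aemeasurable).symm
  rw [h]
  simp only [lintegral_smul hn hF, lintegral_const, Measure.restrict_apply_univ]
  exact ENNReal.mul_lt_top hfin (measure_groupBall_lt_top n R)

/-- The average over a ball at `h x` is at most the average over a larger ball at `x`, by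
unimodularity. -/
theorem ballAvg_smul_le (hn : 2 ≤ n) (h : hypGroup n) {R R' : ℝ}
    (hR : 2 * R * height (h • base n) ≤ R') (x : Hyp n) :
    ballAvg R F (h • x) ≤ ballAvg R' F x := by
  have := isMulRightInvariant_haar hn
  rw [ballAvg, ballAvg, ← lintegral_indicator (isClosed_groupBall n R).measurableSet,
    ← lintegral_indicator (isClosed_groupBall n R').measurableSet,
    ← lintegral_mul_right_eq_self ((groupBall n R').indicator fun g => F (g • x)) h]
  refine lintegral_mono fun g => ?_
  by_cases hg : g ∈ groupBall n R
  · have hg' : g * h ∈ groupBall n R' := by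
      change height ((g * h) • base n) ≤ R'
      rw [mul_smul]
      refine (height_smul_le g _).trans (le_trans ?_ hR)
      have h1 : height (g • base n) ≤ R := hg
      have h2 := height_pos (h • base n)
      gcongr
    simp only [indicator_of_mem hg, indicator_of_mem hg', mul_smul, le_refl]
  · simp only [indicator_of_notMem hg, zero_le]

theorem ballAvg_stabilizer (hn : 2 ≤ n) (s : hypGroup n) (hs : s • base n = base n) (R : ℝ)
    (x : Hyp n) : ballAvg R F (s • x) = ballAvg R F x := by
  have := isMulRightInvariant_haar hn
  rw [ballAvg, ballAvg, ← lintegral_indicator (isClosed_groupBall n R).measurableSet,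
    ← lintegral_indicator (isClosed_groupBall n R).measurableSet,
    ← lintegral_mul_right_eq_self ((groupBall n R).indicator fun g => F (g • x)) s]
  refine lintegral_congr fun g => ?_
  have hiff : g * s ∈ groupBall n R ↔ g ∈ groupBall n R := by
    change height ((g * s) • base n) ≤ R ↔ height (g • base n) ≤ R
    rw [mul_smul, hs]
  by_cases hg : g ∈ groupBall n R
  · simp only [indicator_of_mem hg, indicator_of_mem (hiff.2 hg), mul_smul]
  · simp only [indicator_of_notMem hg, indicator_of_notMem (fun h => hg (hiff.1 h))]

/-- The average is a radial function. -/
theorem ballAvg_eq_of_height_eq (hn : 2 ≤ n) (R : ℝ) {x y : Hyp n} (h : height x = height y) :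
    ballAvg R F x = ballAvg R F y := by
  obtain ⟨s, hs, rfl⟩ := exists_stabilizer_smul_eq hn h
  exact (ballAvg_stabilizer hn s hs R x).symm

theorem hypVolume_ne_zero (hn : 1 ≤ n) : hypVolume n ≠ 0 := by
  intro h
  have h1 := lintegral_critFun_eq_top hn
  rw [h, lintegral_zero_measure] at h1
  exact ENNReal.zero_ne_top h1

/-- The averages of an integrable function are bounded on balls: they are finite almost everywhere,
hence at some point, and `ballAvg_smul_le` moves this point. -/
theorem exists_ballAvg_le (hn : 2 ≤ n) (hF : Measurable F)
    (hfin : ∫⁻ x, F x ∂hypVolume n < ∞) (R T : ℝ) (hR : 0 ≤ R) :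
    ∃ C < ∞, ∀ x : Hyp n, height x ≤ T → ballAvg R F x ≤ C := by
  have hae : ∀ᵐ x ∂hypVolume n, ∀ N : ℕ, ballAvg N F x < ∞ :=
    ae_all_iff.2 fun N => ae_lt_top (measurable_ballAvg hF N)
      (lintegral_ballAvg_lt_top (by omega) hF hfin N).ne
  have : (ae (hypVolume n)).NeBot := ae_neBot.2 (hypVolume_ne_zero (by omega))
  obtain ⟨x₀, hx₀⟩ := hae.exists
  obtain ⟨N, hN⟩ := exists_nat_ge (2 * R * (2 * T * height x₀))
  refine ⟨ballAvg N F x₀, hx₀ N, fun x hx => ?_⟩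
  obtain ⟨a, rfl⟩ := exists_smul_base_eq hn x
  obtain ⟨b, rfl⟩ := exists_smul_base_eq hn x₀
  have e : a • base n = (a * b⁻¹) • b • base n := by rw [mul_smul, inv_smul_smul]
  rw [e]
  refine ballAvg_smul_le hn _ (le_trans ?_ hN) _
  have h1 := height_smul_le a (b⁻¹ • base n)
  rw [height_inv_smul_base] at h1
  rw [mul_smul]
  have h2 := height_pos (b • base n)
  gcongr
  exact h1.trans (by gcongr)

/-- The integral of the averages over `ξ₀` with the weight `xₙ₊₁ ^ (n - k)`. Far from the base point
the weight turns the density `sinh ^ (k - 1)` of `ℍᵏ` into that of `ℍⁿ`. -/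
theorem lintegral_ballAvg_embed_lt_top {k : ℕ} (hk : 1 ≤ k) (hkn : k < n) (hF : Measurable F)
    (hfin : ∫⁻ x, F x ∂hypVolume n < ∞) (R : ℝ) (hR : 0 ≤ R) :
    ∫⁻ y, ballAvg R F (embed hkn.le y) * ENNReal.ofReal (height y ^ (n - k)) ∂hypVolume k < ∞ := by
  have hn : 2 ≤ n := by omega
  have : Nonempty (Fin n) := ⟨⟨0, by omega⟩⟩
  obtain ⟨e⟩ : Nonempty (sphere (0 : EuclideanSpace ℝ (Fin n)) 1) :=
    (NormedSpace.sphere_nonempty.2 zero_le_one).to_subtype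
  set m : ℝ → ℝ≥0∞ := fun ω => ballAvg R F (polar n (ω, e))
  have hMm := measurable_ballAvg hF R
  obtain ⟨C, hC, hCb⟩ := exists_ballAvg_le hn hF hfin R (cosh 1) hR
  have h1 := lintegral_ballAvg_lt_top (by omega) hF hfin R
  rw [lintegral_radial _ hMm m fun q _ => ballAvg_eq_of_height_eq hn R
    (by rw [height_polar, height_polar])] at h1
  have hJ : ∫⁻ ω in Ioi (0 : ℝ), ENNReal.ofReal (sinh ω ^ (n - 1)) * m ω < ∞ := by
    by_contra hJ
    rw [not_lt, top_le_iff] at hJ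
    rw [hJ, ENNReal.top_mul (sphereMass_ne_zero (by omega))] at h1
    exact lt_irrefl _ h1
  have hwm : Measurable fun y : Hyp k => ENNReal.ofReal (height y ^ (n - k)) :=
    (continuous_height.measurable.pow_const _).ennreal_ofReal
  have hMw : Measurable fun y : Hyp k =>
      ballAvg R F (embed hkn.le y) * ENNReal.ofReal (height y ^ (n - k)) :=
    (hMm.comp (continuous_embed hkn.le).measurable).mul hwm
  rw [lintegral_radial _ hMw (fun ω => m ω * ENNReal.ofReal (cosh ω ^ (n - k))) fun q _ => by
      rw [height_polar, ballAvg_eq_of_height_eq hn R (y := polar n (q.1, e))]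
      rw [height_embed, height_polar, height_polar]]
  refine ENNReal.mul_lt_top ?_ (sphereMass_ne_top k).lt_top
  have hsplit : (k - 1) + (n - k) = n - 1 := by omega
  calc ∫⁻ ω in Ioi (0 : ℝ), ENNReal.ofReal (sinh ω ^ (k - 1)) *
        (m ω * ENNReal.ofReal (cosh ω ^ (n - k)))
      ≤ ∫⁻ ω in Ioi (0 : ℝ), (ENNReal.ofReal (2 ^ (n - k)) *
          (ENNReal.ofReal (sinh ω ^ (n - 1)) * m ω) +
          (Ioc (0 : ℝ) 1).indicator (fun _ => ENNReal.ofReal (cosh 1 ^ (n - 1)) * C) ω) := by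
        refine setLIntegral_mono' measurableSet_Ioi fun ω hω => ?_
        have hω0 : 0 < ω := hω
        have hs : 0 < sinh ω := sinh_pos_iff.2 hω0
        have hc := cosh_pos ω
        rw [mul_left_comm, ← ENNReal.ofReal_mul (by positivity), mul_left_comm, mul_comm (m ω)]
        rcases le_or_gt ω 1 with h | h
        · refine le_add_of_nonneg_of_le (zero_le) ?_
          rw [indicator_of_mem (show ω ∈ Ioc (0 : ℝ) 1 from ⟨hω0, h⟩)]
          have hc1 : cosh ω ≤ cosh 1 := by
            rw [cosh_le_cosh, abs_of_pos hω0, abs_one]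
            exact h
          refine mul_le_mul' (ENNReal.ofReal_le_ofReal ?_) (hCb _ (by rwa [height_polar]))
          calc sinh ω ^ (k - 1) * cosh ω ^ (n - k) ≤ cosh 1 ^ (k - 1) * cosh 1 ^ (n - k) := by
                have := (sinh_le_cosh ω).trans hc1
                gcongr
            _ = cosh 1 ^ (n - 1) := by rw [← pow_add, hsplit]
        · refine le_add_of_le_of_nonneg ?_ (zero_le)
          rw [← mul_assoc, mul_comm (ENNReal.ofReal _) (ENNReal.ofReal _),
            ← ENNReal.ofReal_mul (by positivity)]
          refine mul_le_mul' (ENNReal.ofReal_le_ofReal ?_) le_rfl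
          calc sinh ω ^ (k - 1) * cosh ω ^ (n - k)
              ≤ sinh ω ^ (k - 1) * (2 * sinh ω) ^ (n - k) := by
                have := cosh_le_two_mul_sinh h.le
                gcongr
            _ = 2 ^ (n - k) * sinh ω ^ (n - 1) := by
                rw [← hsplit]
                ring
    _ < ∞ := by
        rw [lintegral_add_right _ (measurable_const.indicator measurableSet_Ioc),
          lintegral_const_mul' _ _ ENNReal.ofReal_ne_top,
          lintegral_indicator measurableSet_Ioc, setLIntegral_const]
        refine ENNReal.add_lt_top.2 ⟨ENNReal.mul_lt_top ENNReal.ofReal_lt_top hJ, ?_⟩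
        refine ENNReal.mul_lt_top (ENNReal.mul_lt_top ENNReal.ofReal_lt_top hC) ?_
        refine (Measure.restrict_apply_le _ _).trans_lt ?_
        rw [volume_Ioc]
        exact ENNReal.ofReal_lt_top

/-- The Radon transform of an integrable function with the weight `xₙ₊₁ ^ (n - k)` (in the
coordinates of `ξ₀`) is finite almost everywhere. -/
theorem ae_lintegral_embed_lt_top {k : ℕ} (hk : 1 ≤ k) (hkn : k < n) (hF : Measurable F)
    (hfin : ∫⁻ x, F x ∂hypVolume n < ∞) :
    ∀ᵐ g : hypGroup n ∂Measure.haar,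
      ∫⁻ y, F (g • embed hkn.le y) * ENNReal.ofReal (height y ^ (n - k)) ∂hypVolume k < ∞ := by
  have hm : Measurable fun q : hypGroup n × Hyp k =>
      F (q.1 • embed hkn.le q.2) * ENNReal.ofReal (height q.2 ^ (n - k)) := by
    refine Measurable.mul ?_ ?_
    · exact hF.comp ((continuous_smul_hyp n).comp (continuous_fst.prodMk
        ((continuous_embed hkn.le).comp continuous_snd))).measurable
    · exact ((continuous_height.measurable.comp measurable_snd).pow_const _).ennreal_ofReal
  have h : ∀ N : ℕ, ∀ᵐ g : hypGroup n ∂Measure.haar, g ∈ groupBall n N →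
      ∫⁻ y, F (g • embed hkn.le y) * ENNReal.ofReal (height y ^ (n - k)) ∂hypVolume k < ∞ := by
    intro N
    rw [← ae_restrict_iff' (isClosed_groupBall n N).measurableSet]
    refine ae_lt_top hm.lintegral_prod_right' (ne_of_lt ?_)
    rw [lintegral_lintegral_swap hm.aemeasurable]
    refine lt_of_eq_of_lt (lintegral_congr fun y => ?_)
      (lintegral_ballAvg_embed_lt_top hk hkn hF hfin N N.cast_nonneg)
    exact lintegral_mul_const' _ _ ENNReal.ofReal_ne_top
  filter_upwards [ae_all_iff.2 h] with g hg
  obtain ⟨N, hN⟩ := exists_nat_ge (height (g • base n))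
  exact hg N hN

end Averages

/-! ### Functions in `L^p` -/

section Lp

open Real

/-- The pointwise form of Hölder's inequality: for any `h > 0`, either `a` is below `h ^ (-c)`, or
`a` is at most `a ^ p h ^ (c (p - 1))`. -/
theorem le_rpow_mul_add_rpow {a h c p b : ℝ} (ha : 0 ≤ a) (hh : 1 ≤ h) (hp : 1 ≤ p)
    (hb : c * (p - 1) ≤ b) : a ≤ a ^ p * h ^ b + h ^ (-c) := by
  have h0 : 0 < h := by linarith
  rcases le_or_gt a (h ^ (-c)) with hle | hlt
  · have := rpow_nonneg ha p
    have := rpow_nonneg h0.le b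
    nlinarith [mul_nonneg (rpow_nonneg ha p) (rpow_nonneg h0.le b)]
  · have hc := rpow_pos_of_pos h0 (-c)
    have ha0 : 0 < a := hc.trans hlt
    have h1 : h ^ (-c * (p - 1)) ≤ a ^ (p - 1) := by
      rw [rpow_mul h0.le]
      exact rpow_le_rpow hc.le hlt.le (by linarith)
    have h2 : 1 ≤ a ^ (p - 1) * h ^ b := by
      calc (1 : ℝ) = h ^ (-c * (p - 1)) * h ^ (c * (p - 1)) := by
            rw [← rpow_add h0, neg_mul, neg_add_cancel, rpow_zero]
        _ ≤ a ^ (p - 1) * h ^ b := by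
            have := rpow_le_rpow_of_exponent_le hh hb
            gcongr
    have h3 : a ^ p = a * a ^ (p - 1) := by
      rw [mul_comm, ← rpow_add_one ha0.ne', sub_add_cancel]
    calc a ≤ a * (a ^ (p - 1) * h ^ b) := le_mul_of_one_le_right ha h2
      _ ≤ a ^ p * h ^ b + h ^ (-c) := by
          rw [h3, mul_assoc]
          linarith

theorem integrable_geodesic_of_memLp {𝕜 : Type*} [RCLike 𝕜] {n k : ℕ} (hk : 1 ≤ k) (hkn : k < n)
    {p : ℝ≥0∞} (hp1 : 1 ≤ p) (hp : p < ((n - 1 : ℕ) : ℝ≥0∞) / ((k - 1 : ℕ) : ℝ≥0∞))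
    {f : Hyp n → 𝕜} (hf : MemLp f p (hypVolume n)) :
    ∀ᶠ ξ in aeGeodesic n k, Integrable f (ξ.measure hkn.le) := by
  have hpt : p ≠ ∞ := hp.ne_top
  set P := p.toReal with hP
  have hP1 : 1 ≤ P := by
    have := ENNReal.toReal_mono hpt hp1
    rwa [ENNReal.toReal_one] at this
  have hkR : (1 : ℝ) ≤ k := by exact_mod_cast hk
  have hlt : P * ((k : ℝ) - 1) < (n : ℝ) - 1 := by
    have hn1 : ((n - 1 : ℕ) : ℝ) = (n : ℝ) - 1 := by
      rw [Nat.cast_sub (by omega), Nat.cast_one]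
    have hk1 : ((k - 1 : ℕ) : ℝ) = (k : ℝ) - 1 := by rw [Nat.cast_sub hk, Nat.cast_one]
    rw [← hn1, ← hk1]
    have h := ENNReal.mul_lt_of_lt_div hp
    have := (ENNReal.toReal_lt_toReal (ENNReal.mul_ne_top hpt (ENNReal.natCast_ne_top _))
      (ENNReal.natCast_ne_top _)).2 h
    rwa [ENNReal.toReal_mul, ENNReal.toReal_natCast, ENNReal.toReal_natCast] at this
  obtain ⟨f₀, hf₀, hae⟩ := hf.1
  have hf₀m : Measurable f₀ := hf₀.measurable
  set N := toMeasurable (hypVolume n) {x | f x ≠ f₀ x} with hN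
  have hN0 : hypVolume n N = 0 := by
    rw [hN, measure_toMeasurable]
    exact hae
  have hNm : MeasurableSet N := measurableSet_toMeasurable _ _
  -- The second summand is `0` almost everywhere and takes care of the null set where `f ≠ f₀`.
  set F : Hyp n → ℝ≥0∞ := fun x => ‖f₀ x‖ₑ ^ P + N.indicator (fun _ => ∞) x with hFdef
  have hF₁ : Measurable fun x => ‖f₀ x‖ₑ ^ P := hf₀m.enorm.pow_const _
  have hF : Measurable F := hF₁.add (measurable_const.indicator hNm)
  have hfin : ∫⁻ x, F x ∂hypVolume n < ∞ := by
    rw [hFdef, lintegral_add_left hF₁, lintegral_indicator hNm, setLIntegral_const, hN0, mul_zero,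
      add_zero]
    exact (eLpNorm_lt_top_iff_lintegral_rpow_enorm_lt_top (by
      rintro rfl
      exact absurd hp1 (by simp)) hpt).1 ((memLp_congr_ae hae).1 hf).2
  change ∀ᵐ g ∂Measure.haar, Integrable f ((Geodesic.mk k g).measure hkn.le)
  filter_upwards [ae_lintegral_embed_lt_top hk hkn hF hfin] with g hg
  -- This exponent satisfies both `c > k - 1`, so that `height ^ (-c)` is integrable over `ℍᵏ`, and
  -- `c (p - 1) ≤ n - k`, which is the weight available for `F`.
  set c := ((n : ℝ) - 1) / P with hc
  have hPc : P * c = (n : ℝ) - 1 := by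
    rw [hc]
    field_simp
  have hck : (k : ℝ) - 1 < c := by
    rw [hc, lt_div_iff₀ (by linarith)]
    linarith
  have hcb : c * (P - 1) ≤ ((n - k : ℕ) : ℝ) := by
    rw [Nat.cast_sub hkn.le]
    nlinarith
  have hgm : Measurable fun y => g • embed hkn.le y :=
    ((continuous_const_smul_hyp g).comp (continuous_embed hkn.le)).measurable
  have hwm : Measurable fun y : Hyp k => ENNReal.ofReal (height y ^ (n - k)) :=
    (continuous_height.measurable.pow_const _).ennreal_ofReal
  have hnull : (Geodesic.mk k g).measure hkn.le N = 0 := by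
    have hm : Measurable fun y => N.indicator (1 : Hyp n → ℝ≥0∞) (g • embed hkn.le y) :=
      (measurable_one.indicator hNm).comp hgm
    rw [← lintegral_indicator_one hNm, lintegral_measure_mk hk hkn.le g _
      (measurable_one.indicator hNm), lintegral_eq_zero_iff hm]
    filter_upwards [ae_lt_top ((hF.comp hgm).mul hwm) hg.ne] with y hy
    by_cases hyN : g • embed hkn.le y ∈ N
    · have hw : ENNReal.ofReal (height y ^ (n - k)) ≠ 0 :=
        (ENNReal.ofReal_pos.2 (pow_pos (height_pos y) _)).ne'
      have hFy : F (g • embed hkn.le y) = ∞ := by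
        simp only [hFdef, indicator_of_mem hyN, add_top]
      change F (g • embed hkn.le y) * ENNReal.ofReal (height y ^ (n - k)) < ∞ at hy
      rw [hFy, ENNReal.top_mul hw] at hy
      exact absurd hy (lt_irrefl _)
    · simp only [indicator_of_notMem hyN, Pi.zero_apply]
  have hae' : f₀ =ᵐ[(Geodesic.mk k g).measure hkn.le] f := by
    refine measure_mono_null (fun x hx => ?_) hnull
    exact subset_toMeasurable _ _ (Ne.symm hx)
  refine Integrable.congr ⟨hf₀.aestronglyMeasurable, ?_⟩ hae'
  rw [HasFiniteIntegral, lintegral_measure_mk hk hkn.le g _ hf₀m.enorm]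
  calc ∫⁻ y, ‖f₀ (g • embed hkn.le y)‖ₑ ∂hypVolume k
      ≤ ∫⁻ y, (F (g • embed hkn.le y) * ENNReal.ofReal (height y ^ (n - k)) +
          ENNReal.ofReal (height y ^ (-c))) ∂hypVolume k := by
        refine lintegral_mono fun y => ?_
        have h := le_rpow_mul_add_rpow (norm_nonneg (f₀ (g • embed hkn.le y))) (one_le_height y)
          hP1 hcb
        rw [rpow_natCast] at h
        have hh := height_pos y
        calc ‖f₀ (g • embed hkn.le y)‖ₑ
            ≤ ‖f₀ (g • embed hkn.le y)‖ₑ ^ P * ENNReal.ofReal (height y ^ (n - k)) +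
              ENNReal.ofReal (height y ^ (-c)) := by
              rw [← ofReal_norm, ENNReal.ofReal_rpow_of_nonneg (norm_nonneg _) (by linarith),
                ← ENNReal.ofReal_mul (by positivity), ← ENNReal.ofReal_add (by positivity)
                (by positivity)]
              exact ENNReal.ofReal_le_ofReal h
          _ ≤ _ := by
              gcongr
              exact le_self_add
    _ < ∞ := by
        rw [lintegral_add_right _ (continuous_height.measurable.pow_const _).ennreal_ofReal]
        exact ENNReal.add_lt_top.2 ⟨hg, lintegral_height_rpow_lt_top hk hck⟩

end Lp

end HypRadon

end

theorem theorem4p1 (𝕜 : Type*) [RCLike 𝕜] (n k : ℕ) (hk : 1 ≤ k) (hkn : k < n) :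
    -- (i) functions in `L^p`, almost every `k`-geodesic
    (∀ (p : ℝ≥0∞) (f : HypRadon.Hyp n → 𝕜),
      1 ≤ p → p < ((n - 1 : ℕ) : ℝ≥0∞) / ((k - 1 : ℕ) : ℝ≥0∞) →
      MemLp f p (HypRadon.hypVolume n) →
      ∀ᶠ ξ in HypRadon.aeGeodesic n k, Integrable f (ξ.measure hkn.le)) ∧
    -- (ii) functions in `C_μ`, every `k`-geodesic
    (∀ (μ : ℝ) (f : HypRadon.Hyp n → 𝕜),
      (k : ℝ) - 1 < μ → HypRadon.MemC μ f →
      ∀ ξ : HypRadon.Geodesic n k, Integrable f (ξ.measure hkn.le)) ∧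
    -- the range of `p` is sharp
    (∀ p : ℝ≥0∞, ((n - 1 : ℕ) : ℝ≥0∞) / ((k - 1 : ℕ) : ℝ≥0∞) ≤ p →
      ∃ f : HypRadon.Hyp n → ℝ, Continuous f ∧ (∀ x, 0 ≤ f x) ∧
        MemLp f p (HypRadon.hypVolume n) ∧
        ∀ ξ : HypRadon.Geodesic n k, ∫⁻ x, ENNReal.ofReal (f x) ∂(ξ.measure hkn.le) = ∞) ∧
    -- the range of `μ` is sharp
    (∀ μ : ℝ, μ ≤ (k : ℝ) - 1 →
      ∃ f : HypRadon.Hyp n → ℝ, (∀ x, 0 ≤ f x) ∧ HypRadon.MemC μ f ∧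
        ∀ ξ : HypRadon.Geodesic n k, ∫⁻ x, ENNReal.ofReal (f x) ∂(ξ.measure hkn.le) = ∞) := by
  refine ⟨fun p f hp1 hp hf => HypRadon.integrable_geodesic_of_memLp hk hkn hp1 hp hf,
    fun μ f hμ hf => hf.integrable_geodesic hk hkn.le hμ, fun p hp => ?_, fun μ hμ => ?_⟩
  · exact ⟨HypRadon.critFun n k, HypRadon.continuous_critFun n k,
      fun x => (HypRadon.critFun_pos n k x).le, HypRadon.memLp_critFun hk hkn hp,
      HypRadon.lintegral_critFun_geodesic hk hkn.le⟩
  · exact ⟨HypRadon.critFun n k, fun x => (HypRadon.critFun_pos n k x).le,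
      HypRadon.memC_critFun hk hμ, HypRadon.lintegral_critFun_geodesic hk hkn.le⟩
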